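/- **Setting.** Let $(\Omega,\Upsilon,P)$ be a probability space, $\mathcal X$ a measurable space, $(X_{i,n})_{1\le i\le n,\,n\in\mathbb N}$ an array of $\mathcal X$-valued random variables on $\Omega$, and $\mathcal F$ a class of measurable functions $\mathcal X\to\mathbb R$ with a finite measurable envelope $G$, i.e. $|f(x)|\le G(x)<\infty$ for all $f\in\mathcal F$, $x\in\mathcal X$, and $\mathrm E\,G(X_{i,n})<\infty$ for all $1\le i\le n$. Let $\rho$ be a semimetric on $\mathcal F$ (distinct elements may have distance $0$). For arbitrary $B\subset\Omega$ and arbitrary $Y:\Omega\to[-\infty,\infty]$ put $P^*(B)=\inf\{P(A): B\subset A\in\Upsilon\}$ and $\mathrm E^*Y=\inf\{\mathrm E\,U: U\ge Y,\ U \text{ measurable},\ \mathrm E\,U \text{ exists in } [-\infty,\infty]\}$. Let $\lambda$ be Lebesgue measure, $\mathcal A=\{(u,v]: 0\le u\le v\le 1\}$, $\mathcal F_\delta=\{f-g: f,g\in\mathcal F,\ \rho(f,g)\le\delta\}$, $$S_{n,i,j}(f)=\sum_{k=i}^{j}\big(f(X_{k,n})-\mathrm E f(X_{k,n})\big),$$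 $$\mathbb Z_n^s(A,f)=\frac1{\sqrt n}\sum_{i=1}^n\lambda\big((i-1,i]\cap nA\big)\big(f(X_{i,n})-\mathrm E f(X_{i,n})\big),\qquad A\in\mathcal A,\ f\in\mathcal F,$$ and $\tau((A,f),(B,g))=\lambda(A\triangle B)+\rho(f,g)$. For $\alpha>1$ say that $g:\mathbb N=\{1,2,\dots\}\to\mathbb R$ satisfies condition $(S)$ for $\alpha$ with index $Q\in[1,2^{(\alpha-1)/\alpha})$ if $g\ge 0$, $g$ is nondecreasing, and $g(i)+g(j-i)\le Q\,g(j)$ for all $1\le i<j$. **Theorem.** Suppose that for some $\nu>2$ the following conditions hold. 1. There are $g:\mathbb N\times(0,\infty)\to\mathbb R$ and $Q_g\in[1,2^{1-2/\nu})$ such that $\mathrm E^*\big\{\sup_{f\in\mathcal F_\delta}|S_{n,i,j}(f)|^\nu\big\}\le g(j-i+1,\delta)^{\nu/2}$ for all $\delta>0$ and $1\le i\le j\le n$, and for each $\delta>0$ the function $g(\cdot,\delta)$ satisfies $(S)$ for $\alpha=\nu/2$ with index $Q_g$. 2. There are $h:\mathbb N\to\mathbb R$ and $Q_h\in[1,2^{1-2/\nu})$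 such that $\mathrm E^*\big\{\sup_{f\in\mathcal F}|S_{n,i,j}(f)|^\nu\big\}\le h(j-i+1)^{\nu/2}$ for all $1\le i\le j\le n$, and $h$ satisfies $(S)$ for $\alpha=\nu/2$ with index $Q_h$. 3. $\lim_{\delta\downarrow0}\limsup_{n\to\infty} g(n,\delta)/n=0$. 4. There is a constant $C\ge0$ such that $\limsup_{n\to\infty} h(\lfloor n\varepsilon\rfloor)/n\le C\varepsilon$ for every $0<\varepsilon\le1$. Then $\mathbb Z_n^s$ is asymptotically uniformly equicontinuous in probability with respect to $\tau$: for every $\varepsilon>0$, $$\lim_{\delta\downarrow0}\limsup_{n\to\infty}P^*\Big(\sup_{\tau((A,f),(B,g))\le\delta}\big|\mathbb Z_n^s(A,f)-\mathbb Z_n^s(B,g)\big|>\varepsilon\Big)=0.$$ If, in addition, $(\mathcal F,\rho)$ is totally bounded, then convergence of the finite-dimensional distributions of $\mathbb Z_n^s$ implies its weak convergence in $\ell^\infty(\mathcal A\times\mathcal F)$: if for every finite $I\subset\mathcal A\times\mathcal F$ the random vectors $(\mathbb Z_n^s(A,f))_{(A,f)\in I}$ converge in distribution to some probability law $m_I$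 on $\mathbb R^I$, then there is a tight Borel probability measure $L$ on $\ell^\infty(\mathcal A\times\mathcal F)$ with finite-dimensional marginals $m_I$ such that $\mathrm E^*\{\varphi(\mathbb Z_n^s)\}\to\int\varphi\,dL$ for every bounded continuous $\varphi:\ell^\infty(\mathcal A\times\mathcal F)\to\mathbb R$. -/

import Mathlib

open MeasureTheory Set Filter Topology
open scoped ENNReal Pointwise symmDiff BoundedContinuousFunction

noncomputable section

namespace SmoothedSEP

/-! ### Outer expectation -/

/-- The expectation of an extended real random variable `U` exists: at least one of the expectations
of the positive and the negative part is finite. -/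
def ExpectationExists {Ω : Type*} [MeasurableSpace Ω] (P : Measure Ω) (U : Ω → EReal) : Prop :=
  (∫⁻ ω, (U ω).toENNReal ∂P) ≠ ⊤ ∨ (∫⁻ ω, (-U ω).toENNReal ∂P) ≠ ⊤

/-- The expectation `E U = E U⁺ - E U⁻` in the extended reals (meaningful if it exists). -/
def expectation {Ω : Type*} [MeasurableSpace Ω] (P : Measure Ω) (U : Ω → EReal) : EReal :=
  ((∫⁻ ω, (U ω).toENNReal ∂P : ℝ≥0∞) : EReal) - ((∫⁻ ω, (-U ω).toENNReal ∂P : ℝ≥0∞) : EReal)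

/-- The outer expectation `E* Y` of an arbitrary, possibly nonmeasurable, map `Y`: the infimum of
`E U` over all measurable `U ≥ Y` whose expectation exists. The outer probability `P* B` of an
arbitrary set `B` is Mathlib's `P B`, which is the infimum of `P A` over measurable `A ⊇ B`. -/
def outerExpectation {Ω : Type*} [MeasurableSpace Ω] (P : Measure Ω) (Y : Ω → EReal) : EReal :=
  sInf {e : EReal | ∃ U : Ω → EReal, Measurable U ∧ (∀ ω, Y ω ≤ U ω) ∧
    ExpectationExists P U ∧ e = expectation P U}

/-! ### The space `ℓ^∞(T)` and weak convergence of nonmeasurable maps -/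

/-- Bounded real functions on `T`, with the supremum norm. -/
abbrev EllInfty (T : Type*) : Type _ := lp (fun _ : T => ℝ) ∞

/-- `ℓ^∞(T)` carries the Borel `σ`-field of the supremum norm. -/
instance instMeasurableSpaceEllInfty (T : Type*) : MeasurableSpace (EllInfty T) :=
  borel (EllInfty T)

instance instBorelSpaceEllInfty (T : Type*) : BorelSpace (EllInfty T) := ⟨rfl⟩

/-- `Z_n` converges weakly in `ℓ^∞(T)`, in the sense of Hoffmann-Jørgensen, to the Borel law `L`:
`E* h(Z_n) → ∫ h dL` for every bounded continuous `h`. -/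
def WeaklyConverges {Ω T : Type*} [MeasurableSpace Ω] (P : Measure Ω)
    (Z : ℕ → Ω → EllInfty T) (L : Measure (EllInfty T)) : Prop :=
  ∀ h : EllInfty T →ᵇ ℝ,
    Tendsto (fun n => outerExpectation P (fun ω => ((h (Z n ω) : ℝ) : EReal))) atTop
      (𝓝 ((∫ z, h z ∂L : ℝ) : EReal))

/-- Convergence of the finite-dimensional distributions: for every finite `I ⊆ T`, the random
vector `(Z_n(t))_{t ∈ I}` converges in distribution to the law `m I` on `ℝ^I`. -/
def FidiConverges {Ω T : Type*} [MeasurableSpace Ω] (P : Measure Ω) [IsProbabilityMeasure P]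
    (Z : ℕ → Ω → T → ℝ) (m : ∀ I : Finset T, ProbabilityMeasure (I → ℝ)) : Prop :=
  ∀ I : Finset T, TendstoInDistribution (fun n ω => fun t : I => Z n ω t) atTop
    (fun x : I → ℝ => x) (fun _ => P) (m I : Measure (I → ℝ))

/-- Asymptotic uniform equicontinuity in probability with respect to `τ`: for every `ε > 0`,
`lim_{δ ↓ 0} limsup_n P*(sup_{τ(p,q) ≤ δ} |Z_n(p) - Z_n(q)| > ε) = 0`. -/
def AEC {Ω T : Type*} [MeasurableSpace Ω] (P : Measure Ω)
    (Z : ℕ → Ω → T → ℝ) (τ : T → T → ℝ) : Prop :=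
  ∀ ε : ℝ, 0 < ε →
    Tendsto
      (fun δ : ℝ => limsup (fun n : ℕ =>
        P {ω | ENNReal.ofReal ε < ⨆ (p : T) (q : T) (_ : τ p q ≤ δ), ‖Z n ω p - Z n ω q‖ₑ}) atTop)
      (𝓝[>] 0) (𝓝 0)

/-! ### The array and its smoothed sequential empirical process -/

section Array

variable {Ω 𝓧 : Type*} [MeasurableSpace Ω] [MeasurableSpace 𝓧]

/-- The array `X_{i,n}` (written `X n i`), `1 ≤ i ≤ n`, and the class `F` possess a finite
measurable envelope `G` with `E G(X_{i,n}) < ∞`. -/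
def HasEnvelope (P : Measure Ω) (X : ℕ → ℕ → Ω → 𝓧) (F : Set (𝓧 → ℝ)) : Prop :=
  ∃ G : 𝓧 → ℝ, Measurable G ∧ (∀ f ∈ F, ∀ x, |f x| ≤ G x) ∧
    ∀ n i, 1 ≤ i → i ≤ n → Integrable (fun ω => G (X n i ω)) P

/-- `f(X_{i,n}) - E f(X_{i,n})`. -/
def centered (P : Measure Ω) (X : ℕ → ℕ → Ω → 𝓧) (n i : ℕ) (f : 𝓧 → ℝ) (ω : Ω) : ℝ :=
  f (X n i ω) - ∫ ω', f (X n i ω') ∂P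

/-- The partial sum over `k = i, …, j` of the centered variables in row `n`. -/
def partialSum (P : Measure Ω) (X : ℕ → ℕ → Ω → 𝓧) (n i j : ℕ) (f : 𝓧 → ℝ) (ω : Ω) : ℝ :=
  ∑ k ∈ Finset.Icc i j, centered P X n k f ω

/-- `n^{-1/2} ∑_{i=1}^n λ((i-1,i] ∩ nA) (f(X_{i,n}) - E f(X_{i,n}))`. -/
def smoothedProcess (P : Measure Ω) (X : ℕ → ℕ → Ω → 𝓧) (n : ℕ) (ω : Ω) (A : Set ℝ)
    (f : 𝓧 → ℝ) : ℝ :=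
  (1 / √(n : ℝ)) * ∑ i ∈ Finset.Icc 1 n,
    volume.real (Ioc ((i : ℝ) - 1) (i : ℝ) ∩ (n : ℝ) • A) * centered P X n i f ω

/-- The intervals `(u, v]` with `0 ≤ u ≤ v ≤ 1`. -/
def intervalClass : Set (Set ℝ) :=
  {A | ∃ u v : ℝ, 0 ≤ u ∧ u ≤ v ∧ v ≤ 1 ∧ A = Ioc u v}

/-- The smoothed process indexed by (intervals) × `F`. -/
def smoothedPath (P : Measure Ω) (X : ℕ → ℕ → Ω → 𝓧) (F : Set (𝓧 → ℝ)) (n : ℕ) (ω : Ω)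
    (p : intervalClass × F) : ℝ :=
  smoothedProcess P X n ω p.1 p.2

/-- An envelope makes the sample paths of the smoothed process bounded. -/
theorem memℓp_smoothedPath {P : Measure Ω} {X : ℕ → ℕ → Ω → 𝓧} {F : Set (𝓧 → ℝ)}
    (hF : HasEnvelope P X F) (n : ℕ) (ω : Ω) :
    Memℓp (E := fun _ : intervalClass × F => ℝ) (smoothedPath P X F n ω) ∞ := by
  obtain ⟨G, -, hG, hint⟩ := hF
  refine memℓp_infty ⟨(1 / √(n : ℝ)) * ∑ i ∈ Finset.Icc 1 n,
    1 * (G (X n i ω) + ∫ ω', G (X n i ω') ∂P), ?_⟩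
  rintro _ ⟨⟨A, f, hf⟩, rfl⟩
  simp only [smoothedPath, smoothedProcess, norm_mul]
  rw [Real.norm_of_nonneg (by positivity : (0 : ℝ) ≤ 1 / √(n : ℝ))]
  refine mul_le_mul_of_nonneg_left ((norm_sum_le _ _).trans (Finset.sum_le_sum fun i hi => ?_))
    (by positivity)
  rw [Finset.mem_Icc] at hi
  rw [norm_mul]
  refine mul_le_mul ?_ ?_ (norm_nonneg _) zero_le_one
  · rw [Real.norm_of_nonneg measureReal_nonneg]
    calc volume.real (Ioc ((i : ℝ) - 1) (i : ℝ) ∩ (n : ℝ) • (A : Set ℝ))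
        ≤ volume.real (Ioc ((i : ℝ) - 1) (i : ℝ)) :=
          measureReal_mono inter_subset_left (by simp)
      _ = 1 := by simp
  · refine (norm_sub_le _ _).trans (add_le_add (hG f hf _) ?_)
    exact norm_integral_le_of_norm_le (hint n i hi.1 hi.2)
      (ae_of_all _ fun ω' => hG f hf _)

/-- The smoothed process as a map from `Ω` to `ℓ^∞` over (intervals) × `F`. -/
def smoothedMap {P : Measure Ω} {X : ℕ → ℕ → Ω → 𝓧} {F : Set (𝓧 → ℝ)}
    (hF : HasEnvelope P X F) (n : ℕ) (ω : Ω) : EllInfty (intervalClass × F) :=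
  ⟨smoothedPath P X F n ω, memℓp_smoothedPath hF n ω⟩

/-- The semimetric `λ(A △ B) + ρ(f, g)`. -/
def tau {F : Set (𝓧 → ℝ)} (ρ : PseudoMetricSpace F) (p q : intervalClass × F) : ℝ :=
  volume.real ((p.1 : Set ℝ) ∆ (q.1 : Set ℝ)) + ρ.dist p.2 q.2

/-! ### The moment conditions -/

/-- The differences `f - g` with `f, g ∈ F` and `ρ(f, g) ≤ δ`. -/
def differences {F : Set (𝓧 → ℝ)} (ρ : PseudoMetricSpace F) (δ : ℝ) : Set (𝓧 → ℝ) :=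
  {φ | ∃ f g : F, ρ.dist f g ≤ δ ∧ φ = (f : 𝓧 → ℝ) - (g : 𝓧 → ℝ)}

/-- The growth condition on a pair `(α, g)`, where `g` is a function of the integers `m ≥ 1`,
with index `Q ∈ [1, 2^{(α-1)/α})`. -/
structure GrowthCondition (α : ℝ) (g : ℕ → ℝ) (Q : ℝ) : Prop where
  one_le : 1 ≤ Q
  lt : Q < (2 : ℝ) ^ ((α - 1) / α)
  nonneg : ∀ m, 1 ≤ m → 0 ≤ g m
  mono : ∀ i j, 1 ≤ i → i ≤ j → g i ≤ g j
  add_le : ∀ i j, 1 ≤ i → i < j → g i + g (j - i) ≤ Q * g j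

/-- `E* sup_{φ ∈ 𝓗} |∑_{k=i}^j (φ(X_{k,n}) - E φ(X_{k,n}))|^ν`. -/
def outerMoment (P : Measure Ω) (X : ℕ → ℕ → Ω → 𝓧) (H : Set (𝓧 → ℝ)) (ν : ℝ)
    (n i j : ℕ) : EReal :=
  outerExpectation P
    (fun ω => ((⨆ φ ∈ H, ‖partialSum P X n i j φ ω‖ₑ ^ ν : ℝ≥0∞) : EReal))

/-- The moment conditions with exponent `ν`: bounds `g` for the increments and `h` for the class
itself, with their growth conditions and their asymptotic behaviour. -/
def MomentConditions (P : Measure Ω) (X : ℕ → ℕ → Ω → 𝓧) (F : Set (𝓧 → ℝ))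
    (ρ : PseudoMetricSpace F) (ν : ℝ) : Prop :=
  ∃ (g : ℕ → ℝ → ℝ) (h : ℕ → ℝ) (Qg Qh C : ℝ),
    (∀ n i j : ℕ, ∀ δ : ℝ, 0 < δ → 1 ≤ i → i ≤ j → j ≤ n →
      outerMoment P X (differences ρ δ) ν n i j ≤ ((g (j - i + 1) δ ^ (ν / 2) : ℝ) : EReal)) ∧
    (∀ δ : ℝ, 0 < δ → GrowthCondition (ν / 2) (fun m => g m δ) Qg) ∧
    (∀ n i j : ℕ, 1 ≤ i → i ≤ j → j ≤ n →
      outerMoment P X F ν n i j ≤ ((h (j - i + 1) ^ (ν / 2) : ℝ) : EReal)) ∧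
    GrowthCondition (ν / 2) h Qh ∧
    Tendsto (fun δ : ℝ => limsup (fun n : ℕ => ((g n δ / n : ℝ) : EReal)) atTop)
      (𝓝[>] 0) (𝓝 0) ∧
    0 ≤ C ∧
    ∀ ε : ℝ, 0 < ε → ε ≤ 1 →
      limsup (fun n : ℕ => ((h ⌊(n : ℝ) * ε⌋₊ / n : ℝ) : EReal)) atTop ≤ ((C * ε : ℝ) : EReal)

end Array

end SmoothedSEP

end

noncomputable section

namespace SmoothedSEP

/-! ### Outer expectation -/

section OuterExpectation

variable {Ω : Type*} [MeasurableSpace Ω] {P : Measure Ω}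

/-! For fixed `f`, the value of the process on `(u, v]` is `n^{-1/2}` times the increment over `[nu,
nv]` of the piecewise linear interpolation of the centered partial sums. Hence a difference at two
`tau`-close points splits into two effects: changing the function, which costs maximal partial sums
over the class of differences, and moving the end points, which costs the oscillation of the
interpolation over distances of order `n δ`.

Both are controlled by a maximal inequality of Móricz type (`exists_measurable_maximal`), which
passes the moment bound from single partial sums to their maximum. Suprema need not be measurable,
so everything is carried by measurable majorants. By Markov's inequality the first effect has
probability of order `(g(n,δ)/n)^{ν/2}`. For the second, `[0, n]` is cut into about `1/δ` blocks of
length about `2nδ`, each bad with probability of order `δ^{ν/2}`; the sum is of order `δ^{ν/2-1}`,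
which vanishes because `ν > 2`. This is `aec_smoothedPath`.

For weak convergence, equicontinuity and total boundedness approximate the process by its values on
a finite net, extended as a step function. These step functions are measurable and converge in law.
`exists_weak_limit_of_approximation` shows that their limit laws are jointly tight, that a cluster
point of them is the weak limit, and that this limit is tight; its marginals are then read off. -/

theorem expectation_coe_real {U : Ω → ℝ} (hU : Integrable U P) :
    expectation P (fun ω => (U ω : EReal)) = ((∫ ω, U ω ∂P : ℝ) : EReal) := by
  have h1 : ∫⁻ ω, ENNReal.ofReal (U ω) ∂P ≠ ⊤ := hU.lintegral_lt_top.ne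
  have h2 : ∫⁻ ω, ENNReal.ofReal (-U ω) ∂P ≠ ⊤ := hU.neg.lintegral_lt_top.ne
  rw [integral_eq_lintegral_pos_part_sub_lintegral_neg_part hU, EReal.coe_sub,
    EReal.coe_ennreal_toReal h1, EReal.coe_ennreal_toReal h2]
  simp only [expectation, ← EReal.coe_neg, EReal.real_coe_toENNReal]

theorem expectation_mono {U V : Ω → EReal} (h : ∀ ω, U ω ≤ V ω) :
    expectation P U ≤ expectation P V := by
  refine EReal.sub_le_sub ?_ ?_
  · exact EReal.coe_ennreal_le_coe_ennreal_iff.2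
      (lintegral_mono fun ω => EReal.toENNReal_le_toENNReal (h ω))
  · exact EReal.coe_ennreal_le_coe_ennreal_iff.2
      (lintegral_mono fun ω => EReal.toENNReal_le_toENNReal (EReal.neg_le_neg_iff.2 (h ω)))

theorem outerExpectation_mono {Y Y' : Ω → EReal} (h : ∀ ω, Y ω ≤ Y' ω) :
    outerExpectation P Y ≤ outerExpectation P Y' := by
  refine sInf_le_sInf ?_
  rintro e ⟨U, hU, hYU, hex, rfl⟩
  exact ⟨U, hU, fun ω => (h ω).trans (hYU ω), hex, rfl⟩

theorem outerExpectation_le_integral {Y : Ω → EReal} {U : Ω → ℝ} (hUm : Measurable U)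
    (hU : Integrable U P) (h : ∀ ω, Y ω ≤ U ω) :
    outerExpectation P Y ≤ ((∫ ω, U ω ∂P : ℝ) : EReal) := by
  refine sInf_le ⟨fun ω => (U ω : EReal), measurable_coe_real_ereal.comp hUm, h, Or.inl ?_,
    (expectation_coe_real hU).symm⟩
  simpa only [EReal.real_coe_toENNReal] using hU.lintegral_lt_top.ne

theorem integral_le_outerExpectation {Y : Ω → EReal} {V : Ω → ℝ} (hV : Integrable V P)
    (h : ∀ ω, (V ω : EReal) ≤ Y ω) :
    ((∫ ω, V ω ∂P : ℝ) : EReal) ≤ outerExpectation P Y := by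
  refine le_sInf ?_
  rintro e ⟨U, -, hYU, -, rfl⟩
  rw [← expectation_coe_real hV]
  exact expectation_mono fun ω => (h ω).trans (hYU ω)

theorem outerExpectation_coe_real {U : Ω → ℝ} (hUm : Measurable U) (hU : Integrable U P) :
    outerExpectation P (fun ω => (U ω : EReal)) = ((∫ ω, U ω ∂P : ℝ) : EReal) :=
  le_antisymm (outerExpectation_le_integral hUm hU fun _ => le_rfl)
    (integral_le_outerExpectation hU fun _ => le_rfl)

/-- A nonnegative map with outer expectation at most `c` has a measurable majorant with
integral at most `c`. -/
theorem exists_measurable_majorant {Y : Ω → ℝ≥0∞} {c : ℝ}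
    (h : outerExpectation P (fun ω => (Y ω : EReal)) ≤ (c : EReal)) :
    ∃ U : Ω → ℝ≥0∞, Measurable U ∧ (∀ ω, Y ω ≤ U ω) ∧ ∫⁻ ω, U ω ∂P ≤ ENNReal.ofReal c := by
  have key : ∀ k : ℕ, ∃ U : Ω → ℝ≥0∞, Measurable U ∧ (∀ ω, Y ω ≤ U ω) ∧
      ∫⁻ ω, U ω ∂P ≤ ENNReal.ofReal (c + 1 / ((k : ℝ) + 1)) := by
    intro k
    have hlt : outerExpectation P (fun ω => (Y ω : EReal)) <
        ((c + 1 / ((k : ℝ) + 1) : ℝ) : EReal) := by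
      refine h.trans_lt (EReal.coe_lt_coe_iff.2 ?_)
      have : (0 : ℝ) < 1 / ((k : ℝ) + 1) := by positivity
      linarith
    obtain ⟨e, ⟨U, hUm, hYU, -, rfl⟩, he⟩ := sInf_lt_iff.1 hlt
    have hU0 : ∀ ω, 0 ≤ U ω := fun ω => (EReal.coe_ennreal_nonneg _).trans (hYU ω)
    refine ⟨fun ω => (U ω).toENNReal, hUm.ereal_toENNReal, fun ω => ?_, ?_⟩
    · simpa only [EReal.toENNReal_coe] using EReal.toENNReal_le_toENNReal (hYU ω)
    -- A majorant of a nonnegative map has no negative part, so its expectation is the integral of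
    -- its positive part.
    · have h0 : ∀ ω, (-U ω).toENNReal = 0 := fun ω =>
        EReal.toENNReal_of_nonpos (by simpa using EReal.neg_le_neg_iff.2 (hU0 ω))
      simp only [expectation, h0, lintegral_zero, EReal.coe_ennreal_zero, sub_zero] at he
      have := EReal.toENNReal_le_toENNReal he.le
      simpa only [EReal.toENNReal_coe, EReal.real_coe_toENNReal] using this
  choose U hUm hYU hUi using key
  -- The countable infimum of majorants is again a measurable majorant and removes the slack
  -- `1/(k+1)`.
  refine ⟨fun ω => ⨅ k, U k ω, Measurable.iInf hUm, fun ω => le_iInf fun k => hYU k ω, ?_⟩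
  have hlim : Tendsto (fun k : ℕ => ENNReal.ofReal (c + 1 / ((k : ℝ) + 1))) atTop
      (𝓝 (ENNReal.ofReal c)) := by
    refine ENNReal.tendsto_ofReal ?_
    simpa using tendsto_one_div_add_atTop_nhds_zero_nat.const_add c
  exact ge_of_tendsto' hlim fun k =>
    (lintegral_mono fun ω => iInf_le (fun k => U k ω) k).trans (hUi k)

end OuterExpectation

/-! ### Lipschitz approximation of continuous functions -/

/-- A bounded continuous function is the pointwise limit from below of Lipschitz functions with the
same bound. -/
theorem exists_lipschitz_tendsto_of_le {E : Type*} [PseudoMetricSpace E] (φ : E →ᵇ ℝ) :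
    ∃ ψ : ℕ → E → ℝ, (∀ m : ℕ, LipschitzWith m (ψ m)) ∧ (∀ m x, ψ m x ≤ φ x) ∧
      (∀ m x, |ψ m x| ≤ ‖φ‖) ∧ ∀ x, Tendsto (fun m => ψ m x) atTop (𝓝 (φ x)) := by
  have hφ : ∀ x, |φ x| ≤ ‖φ‖ := fun x => φ.norm_coe_le_norm x
  have hb : ∀ (m : ℕ) x y, -‖φ‖ ≤ φ y + m * dist x y := fun m x y => by
    have := (abs_le.1 (hφ y)).1
    have : 0 ≤ m * dist x y := by positivity
    linarith
  have hbdd : ∀ (m : ℕ) x, BddBelow (range fun y => φ y + m * dist x y) := fun m x =>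
    ⟨-‖φ‖, by rintro _ ⟨y, rfl⟩; exact hb m x y⟩
  have hle : ∀ (m : ℕ) x, ⨅ y, (φ y + m * dist x y) ≤ φ x := fun m x =>
    (ciInf_le (hbdd m x) x).trans (by simp)
  -- Infimal convolution of `φ` with `m * dist`. For large `m`, points `y` at distance at least `δ`
  -- from `x` pay a penalty of `2‖φ‖` or more, so only nearby values of `φ` can compete.
  refine ⟨fun m x => ⨅ y, (φ y + m * dist x y), fun m => ?_, hle, fun m x => ?_, fun x => ?_⟩
  · refine LipschitzWith.of_le_add_mul _ fun x y => ?_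
    have : Nonempty E := ⟨x⟩
    rw [← sub_le_iff_le_add]
    refine le_ciInf fun z => ?_
    rw [sub_le_iff_le_add]
    refine (ciInf_le (hbdd m x) z).trans ?_
    have := mul_le_mul_of_nonneg_left (dist_triangle x y z) (Nat.cast_nonneg (α := ℝ) m)
    simp only [NNReal.coe_natCast]
    linarith
  · have : Nonempty E := ⟨x⟩
    exact abs_le.2 ⟨le_ciInf fun y => hb m x y, (hle m x).trans (le_of_abs_le (hφ x))⟩
  · have : Nonempty E := ⟨x⟩
    refine tendsto_order.2 ⟨fun a ha => ?_, fun a ha =>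
      Eventually.of_forall fun m => (hle m x).trans_lt ha⟩
    obtain ⟨b, hab, hbx⟩ := exists_between ha
    obtain ⟨δ, hδ, hball⟩ := Metric.eventually_nhds_iff.1
      (φ.continuous.continuousAt.eventually (lt_mem_nhds hbx))
    obtain ⟨m₀, hm₀⟩ := exists_nat_ge (2 * ‖φ‖ / δ)
    filter_upwards [eventually_ge_atTop m₀] with m hm
    refine hab.trans_le (le_ciInf fun y => ?_)
    by_cases hy : dist y x < δ
    · have := (hball hy).le
      have : 0 ≤ m * dist x y := by positivity
      linarith
    · have h1 : 2 * ‖φ‖ ≤ m * dist x y := by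
        rw [div_le_iff₀ hδ] at hm₀
        refine hm₀.trans (mul_le_mul (by exact_mod_cast hm) ?_ hδ.le (Nat.cast_nonneg m))
        rw [dist_comm]; exact not_lt.1 hy
      have h2 := (abs_le.1 (hφ y)).1
      have h3 := (abs_le.1 (hφ x)).2
      linarith

/-! ### Tightness and weak convergence in a complete metric space -/

section WeakLimit

variable {E : Type*} [MeasurableSpace E]

/-- Finitely many early laws are individually tight, so enlarging the net removes the word
"eventually". Intersecting the ball unions of radius `1/(j+1)`, with lost masses summing to less
than `η`, gives a closed totally bounded set, compact by completeness. -/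
theorem isTightMeasureSet_range_of_eventually [MetricSpace E] [CompleteSpace E] [BorelSpace E]
    (μ : ℕ → Measure E) (hμ : ∀ k, IsTightMeasureSet {μ k})
    (h : ∀ ε : ℝ, 0 < ε → ∀ η : ℝ≥0∞, 0 < η → ∃ N : Set E, N.Finite ∧
      ∀ᶠ k in atTop, μ k (⋃ x ∈ N, Metric.closedBall x ε)ᶜ ≤ η) :
    IsTightMeasureSet (range μ) := by
  have h' : ∀ ε : ℝ, 0 < ε → ∀ η : ℝ≥0∞, 0 < η → ∃ N : Set E, N.Finite ∧
      ∀ k, μ k (⋃ x ∈ N, Metric.closedBall x ε)ᶜ ≤ η := by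
    intro ε hε η hη
    obtain ⟨N, hN, hk⟩ := h ε hε η hη
    obtain ⟨k₀, hk₀⟩ := eventually_atTop.1 hk
    have hM : ∀ k, ∃ M : Set E, M.Finite ∧ μ k (⋃ x ∈ M, Metric.closedBall x ε)ᶜ ≤ η := by
      intro k
      obtain ⟨K, hK, hKη⟩ :=
        isTightMeasureSet_iff_exists_isCompact_measure_compl_le.1 (hμ k) η hη
      obtain ⟨M, hM, hKM⟩ := Metric.totallyBounded_iff.1 hK.totallyBounded ε hε
      refine ⟨M, hM, (measure_mono (compl_subset_compl.2 (hKM.trans ?_))).trans (hKη _ rfl)⟩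
      exact iUnion₂_mono fun x _ => Metric.ball_subset_closedBall
    choose M hMfin hMη using hM
    refine ⟨N ∪ ⋃ k ∈ Iio k₀, M k, hN.union ((finite_Iio k₀).biUnion fun k _ => hMfin k),
      fun k => ?_⟩
    rcases lt_or_ge k k₀ with hlt | hge
    · refine (measure_mono (compl_subset_compl.2 (biUnion_subset_biUnion_left ?_))).trans (hMη k)
      exact (subset_biUnion_of_mem (u := M) (show k ∈ Iio k₀ from hlt)).trans subset_union_right
    · exact (measure_mono (compl_subset_compl.2
        (biUnion_subset_biUnion_left subset_union_left))).trans (hk₀ k hge)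
  rw [isTightMeasureSet_iff_exists_isCompact_measure_compl_le]
  intro η hη
  obtain ⟨e, he, hsum⟩ := ENNReal.exists_pos_sum_of_countable' hη.ne' ℕ
  choose N hN hNe using fun j : ℕ => h' (1 / ((j : ℝ) + 1)) (by positivity) (e j) (he j)
  refine ⟨⋂ j : ℕ, ⋃ x ∈ N j, Metric.closedBall x (1 / ((j : ℝ) + 1)), ?_, ?_⟩
  · refine TotallyBounded.isCompact_of_isComplete ?_ (IsClosed.isComplete ?_)
    · refine Metric.totallyBounded_iff.2 fun ε hε => ?_
      obtain ⟨j, hj⟩ := exists_nat_one_div_lt hε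
      exact ⟨N j, hN j, (iInter_subset _ j).trans
        (iUnion₂_mono fun x _ => Metric.closedBall_subset_ball hj)⟩
    · exact isClosed_iInter fun j => (hN j).isClosed_biUnion fun x _ => Metric.isClosed_closedBall
  · rintro _ ⟨k, rfl⟩
    rw [compl_iInter]
    exact (measure_iUnion_le _).trans ((ENNReal.tsum_le_tsum fun j => hNe j k).trans hsum.le)

/-- The complement of a compact set is open, so by the portmanteau theorem its limit mass is at most
the liminf of its masses. -/
theorem isTightMeasureSet_singleton_of_tendsto [TopologicalSpace E] [T2Space E]
    [OpensMeasurableSpace E] [HasOuterApproxClosed E] {ι : Type*} {l : Filter ι} [l.NeBot]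
    {μ : ι → ProbabilityMeasure E} {ν : ProbabilityMeasure E} (h : Tendsto μ l (𝓝 ν))
    (hμ : IsTightMeasureSet (range fun i => (μ i : Measure E))) :
    IsTightMeasureSet {(ν : Measure E)} := by
  rw [isTightMeasureSet_iff_exists_isCompact_measure_compl_le] at hμ ⊢
  intro η hη
  obtain ⟨K, hK, hKη⟩ := hμ η hη
  refine ⟨K, hK, ?_⟩
  rintro _ rfl
  refine (ProbabilityMeasure.le_liminf_measure_open_of_tendsto h
    hK.isClosed.isOpen_compl).trans (le_trans liminf_le_limsup ?_)
  exact limsup_le_of_le (h := Eventually.of_forall fun i => hKη _ ⟨i, rfl⟩)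

end WeakLimit

theorem tendsto_coe_ereal_of_forall_eventually {ι : Type*} {l : Filter ι} {a : ι → EReal} {c : ℝ}
    (h : ∀ ε : ℝ, 0 < ε → ∀ᶠ n in l, ((c - ε : ℝ) : EReal) ≤ a n ∧ a n ≤ ((c + ε : ℝ) : EReal)) :
    Tendsto a l (𝓝 (c : EReal)) := by
  refine tendsto_order.2 ⟨fun b hb => ?_, fun b hb => ?_⟩
  · obtain ⟨r, hbr, hrc⟩ := EReal.lt_iff_exists_real_btwn.1 hb
    have hrc' : r < c := EReal.coe_lt_coe_iff.1 hrc
    filter_upwards [h (c - r) (by linarith)] with n hn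
    rw [sub_sub_cancel] at hn
    exact hbr.trans_le hn.1
  · obtain ⟨r, hcr, hrb⟩ := EReal.lt_iff_exists_real_btwn.1 hb
    have hcr' : c < r := EReal.coe_lt_coe_iff.1 hcr
    filter_upwards [h (r - c) (by linarith)] with n hn
    rw [add_sub_cancel] at hn
    exact hn.2.trans_lt hrb

/-! ### Weak limits of arbitrary maps approximated by measurable ones -/

section Approximation

variable {Ω E : Type*} [MeasurableSpace Ω] {P : Measure Ω} [MeasurableSpace E]

/-- A Lipschitz functional has almost the same outer expectation at two maps that are close with
high probability, if one of them is measurable. -/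
theorem outerExpectation_lipschitz_near [IsProbabilityMeasure P] [PseudoMetricSpace E] [OpensMeasurableSpace E]
    {ψ : E → ℝ} {C : NNReal} (hψ : LipschitzWith C ψ) {B : ℝ} (hB : ∀ x, |ψ x| ≤ B)
    {Z Y : Ω → E} (hY : Measurable Y) {ε η : ℝ} (hε : 0 ≤ ε) (hη : 0 ≤ η)
    (h : P {ω | ε < dist (Z ω) (Y ω)} ≤ ENNReal.ofReal η) :
    ((∫ ω, ψ (Y ω) ∂P - (C * ε + 2 * B * η) : ℝ) : EReal) ≤
        outerExpectation P (fun ω => (ψ (Z ω) : EReal)) ∧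
      outerExpectation P (fun ω => (ψ (Z ω) : EReal)) ≤
        ((∫ ω, ψ (Y ω) ∂P + (C * ε + 2 * B * η) : ℝ) : EReal) := by
  have hB0 : 0 ≤ B := by
    obtain ⟨ω⟩ : Nonempty Ω := nonempty_of_isProbabilityMeasure P
    exact (abs_nonneg _).trans (hB (Y ω))
  -- The measurable hull has the same outer probability, which makes the error bound `D` integrable.
  set A := toMeasurable P {ω | ε < dist (Z ω) (Y ω)} with hA
  have hAm : MeasurableSet A := measurableSet_toMeasurable _ _
  have hAη : P.real A ≤ η := by
    rw [measureReal_def, hA, measure_toMeasurable]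
    exact ENNReal.toReal_le_of_le_ofReal hη h
  have hψm : Measurable fun ω => ψ (Y ω) := hψ.continuous.measurable.comp hY
  have hψi : Integrable (fun ω => ψ (Y ω)) P :=
    Integrable.of_bound hψm.aestronglyMeasurable B (ae_of_all _ fun ω => hB _)
  set D : Ω → ℝ := fun ω => C * ε + 2 * B * A.indicator (fun _ => 1) ω with hD
  have hDm : Measurable D := by
    refine measurable_const.add (Measurable.const_mul ?_ _)
    exact measurable_const.indicator hAm
  have hIi : Integrable (A.indicator fun _ => (1 : ℝ)) P :=
    (integrable_const 1).indicator hAm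
  have hDi : Integrable D P := (integrable_const _).add (hIi.const_mul _)
  have hDint : ∫ ω, D ω ∂P ≤ C * ε + 2 * B * η := by
    rw [hD, integral_add (integrable_const _) (hIi.const_mul _), integral_const,
      integral_const_mul (2 * B), integral_indicator_const _ hAm]
    simp only [probReal_univ, smul_eq_mul, one_mul, mul_one]
    have := mul_le_mul_of_nonneg_left hAη (by positivity : (0 : ℝ) ≤ 2 * B)
    linarith
  have hclose : ∀ ω, |ψ (Z ω) - ψ (Y ω)| ≤ D ω := by
    intro ω
    have h2 : |ψ (Z ω) - ψ (Y ω)| ≤ C * dist (Z ω) (Y ω) := by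
      simpa [Real.dist_eq] using hψ.dist_le_mul (Z ω) (Y ω)
    by_cases hω : ω ∈ A
    · simp only [hD, indicator_of_mem hω]
      have h1 : |ψ (Z ω) - ψ (Y ω)| ≤ B + B := (abs_sub _ _).trans (add_le_add (hB _) (hB _))
      have : 0 ≤ C * ε := by positivity
      linarith
    · simp only [hD, indicator_of_notMem hω]
      have h1 : dist (Z ω) (Y ω) ≤ ε := by
        by_contra hlt
        exact hω (subset_toMeasurable _ _ (not_le.1 hlt))
      have := mul_le_mul_of_nonneg_left h1 C.2
      simp only [NNReal.val_eq_coe] at this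
      linarith
  constructor
  · refine le_trans (EReal.coe_le_coe_iff.2 ?_) (integral_le_outerExpectation (hψi.sub hDi)
      fun ω => EReal.coe_le_coe_iff.2 ?_)
    · rw [integral_sub' hψi hDi]; linarith
    · have := (abs_le.1 (hclose ω)).1
      simp only [Pi.sub_apply]; linarith
  · refine le_trans (outerExpectation_le_integral (hψm.add hDm) (hψi.add hDi)
      fun ω => EReal.coe_le_coe_iff.2 ?_) (EReal.coe_le_coe_iff.2 ?_)
    · have := (abs_le.1 (hclose ω)).2
      simp only [Pi.add_apply]; linarith
    · rw [integral_add' hψi hDi]; linarith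

variable [MetricSpace E] [CompleteSpace E] [BorelSpace E]

/-- A single good index `j` serves as a reference: a finite net for most of the mass of `ν j` also
works for every late `ν k`, since for large `n` both `Y j n` and `Y k n` are close to the same `Z
n`. The portmanteau theorem transfers this to the limits. -/
theorem isTightMeasureSet_range_of_approximation (Z : ℕ → Ω → E) (Y : ℕ → ℕ → Ω → E)
    (hY : ∀ k n, Measurable (Y k n)) (ν : ℕ → ProbabilityMeasure E)
    (hν : ∀ k, IsTightMeasureSet {(ν k : Measure E)})
    (Λ : ℕ → ℕ → ProbabilityMeasure E) (hΛ : ∀ k n, (Λ k n : Measure E) = P.map (Y k n))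
    (hconv : ∀ k, Tendsto (Λ k) atTop (𝓝 (ν k)))
    (happrox : ∀ ε : ℝ, 0 < ε → ∀ η : ℝ≥0∞, 0 < η → ∀ᶠ k in atTop, ∀ᶠ n in atTop,
      P {ω | ε < dist (Z n ω) (Y k n ω)} ≤ η) :
    IsTightMeasureSet (range fun k => (ν k : Measure E)) := by
  refine isTightMeasureSet_range_of_eventually _ hν fun ε hε η hη => ?_
  obtain ⟨r, hr0, hrη⟩ := ENNReal.lt_iff_exists_nnreal_btwn.1 hη
  -- Of the budget `4κ`, `2κ` goes to `Y j n` leaving the net (`κ` for the limit law, doubled for a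
  -- strict inequality in the limsup) and `κ` to each of the two approximation errors.
  obtain ⟨κ, rfl⟩ : ∃ κ : NNReal, r = 4 * κ := ⟨r / 4, by field_simp⟩
  have hκ : (0 : ℝ≥0∞) < κ := by
    rw [ENNReal.coe_pos] at hr0 ⊢
    exact pos_of_mul_pos_right hr0 zero_le_four
  have hev := happrox (ε / 3) (by positivity) κ hκ
  obtain ⟨j, hj⟩ := hev.exists
  obtain ⟨K, hK, hKη⟩ :=
    isTightMeasureSet_iff_exists_isCompact_measure_compl_le.1 (hν j) κ hκ
  obtain ⟨N, hN, hKN⟩ := Metric.totallyBounded_iff.1 hK.totallyBounded (ε / 3) (by positivity)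
  refine ⟨N, hN, ?_⟩
  have hUopen : IsOpen (⋃ x ∈ N, Metric.ball x (ε / 3)) :=
    isOpen_biUnion fun x _ => Metric.isOpen_ball
  have hUclosed := hUopen.isClosed_compl
  have hCopen : IsOpen (⋃ x ∈ N, Metric.closedBall x ε)ᶜ :=
    (hN.isClosed_biUnion fun x _ => Metric.isClosed_closedBall).isOpen_compl
  have hκ2 : (κ : ℝ≥0∞) < 2 * κ := by
    rw [two_mul]
    exact ENNReal.lt_add_right ENNReal.coe_ne_top hκ.ne'
  have hlim : ∀ᶠ n in atTop, P (Y j n ⁻¹' (⋃ x ∈ N, Metric.ball x (ε / 3))ᶜ) < 2 * κ := by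
    have h1 := ProbabilityMeasure.limsup_measure_closed_le_of_tendsto (hconv j) hUclosed
    have h2 : (ν j : Measure E) (⋃ x ∈ N, Metric.ball x (ε / 3))ᶜ ≤ κ :=
      (measure_mono (compl_subset_compl.2 hKN)).trans (hKη _ rfl)
    filter_upwards [eventually_lt_of_limsup_lt ((h1.trans h2).trans_lt hκ2)] with n hn
    rwa [hΛ,
      Measure.map_apply (hY j n) hUclosed.measurableSet] at hn
  filter_upwards [hev] with k hk
  refine (ProbabilityMeasure.le_liminf_measure_open_of_tendsto (hconv k) hCopen).trans
    (le_trans liminf_le_limsup (limsup_le_of_le (h := ?_)))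
  filter_upwards [hlim, hj, hk] with n h1 h2 h3
  rw [hΛ, Measure.map_apply (hY k n) hCopen.measurableSet]
  have hsub : Y k n ⁻¹' (⋃ x ∈ N, Metric.closedBall x ε)ᶜ ⊆
      Y j n ⁻¹' (⋃ x ∈ N, Metric.ball x (ε / 3))ᶜ ∪
        ({ω | ε / 3 < dist (Z n ω) (Y j n ω)} ∪ {ω | ε / 3 < dist (Z n ω) (Y k n ω)}) := by
    intro ω hω
    by_contra hcon
    simp only [mem_union, not_or, mem_ofPred_eq, not_lt, mem_preimage, mem_compl_iff,
      not_not, mem_iUnion] at hcon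
    obtain ⟨⟨x, hxN, hx⟩, hZj, hZk⟩ := hcon
    refine hω (mem_biUnion hxN ?_)
    rw [Metric.mem_ball] at hx
    rw [Metric.mem_closedBall]
    have h4 := dist_triangle4 (Y k n ω) (Z n ω) (Y j n ω) x
    rw [dist_comm (Y k n ω) (Z n ω)] at h4
    linarith
  calc P (Y k n ⁻¹' (⋃ x ∈ N, Metric.closedBall x ε)ᶜ)
      ≤ 2 * κ + (κ + κ) := (measure_mono hsub).trans ((measure_union_le _ _).trans
        (add_le_add h1.le ((measure_union_le _ _).trans (add_le_add h2 h3))))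
    _ = (4 * κ : NNReal) := by push_cast; ring
    _ ≤ η := hrη.le

/-- Arbitrary maps that are approximated in probability, uniformly in `n` large, by measurable maps
with convergent laws converge weakly to a tight law. -/
theorem exists_weak_limit_of_approximation [IsProbabilityMeasure P] (Z : ℕ → Ω → E)
    (Y : ℕ → ℕ → Ω → E)
    (hY : ∀ k n, Measurable (Y k n)) (ν : ℕ → ProbabilityMeasure E)
    (hν : ∀ k, IsTightMeasureSet {(ν k : Measure E)})
    (Λ : ℕ → ℕ → ProbabilityMeasure E) (hΛ : ∀ k n, (Λ k n : Measure E) = P.map (Y k n))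
    (hconv : ∀ k, Tendsto (Λ k) atTop (𝓝 (ν k)))
    (happrox : ∀ ε : ℝ, 0 < ε → ∀ η : ℝ≥0∞, 0 < η → ∀ᶠ k in atTop, ∀ᶠ n in atTop,
      P {ω | ε < dist (Z n ω) (Y k n ω)} ≤ η) :
    ∃ L : ProbabilityMeasure E, IsTightMeasureSet {(L : Measure E)} ∧ ∀ φ : E →ᵇ ℝ,
      Tendsto (fun n => outerExpectation P (fun ω => ((φ (Z n ω) : ℝ) : EReal))) atTop
        (𝓝 ((∫ z, φ z ∂(L : Measure E) : ℝ) : EReal)) := by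
  have htight := isTightMeasureSet_range_of_approximation Z Y hY ν hν Λ hΛ hconv happrox
  have hcomp : IsCompact (closure (range ν)) := by
    refine isCompact_closure_of_isTightMeasureSet (htight.subset ?_)
    rintro _ ⟨_, ⟨k, rfl⟩, rfl⟩
    exact ⟨k, rfl⟩
  -- Any cluster point of the laws `ν k` will do: the approximation forces convergence along all `n`
  -- to its integrals. An ultrafilter finer than `atTop` supplies one.
  obtain ⟨L, -, hL⟩ := hcomp.ultrafilter_le_nhds ((hyperfilter ℕ).map ν) (by
    rw [Ultrafilter.coe_map, le_principal_iff]
    exact mem_map.2 (univ_mem' fun k => subset_closure ⟨k, rfl⟩))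
  have hL' : Tendsto ν (hyperfilter ℕ : Filter ℕ) (𝓝 L) := hL
  have hle : (hyperfilter ℕ : Filter ℕ) ≤ atTop := Nat.hyperfilter_le_atTop
  refine ⟨L, isTightMeasureSet_singleton_of_tendsto hL' htight, ?_⟩
  have hlip : ∀ (ψ : E → ℝ) (C : NNReal) (B : ℝ), LipschitzWith C ψ → (∀ x, |ψ x| ≤ B) →
      Tendsto (fun n => outerExpectation P (fun ω => ((ψ (Z n ω) : ℝ) : EReal))) atTop
        (𝓝 ((∫ z, ψ z ∂(L : Measure E) : ℝ) : EReal)) := by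
    intro ψ C B hψ hB
    let ψ' : E →ᵇ ℝ := BoundedContinuousFunction.ofNormedAddCommGroup ψ hψ.continuous B hB
    have hB0 : 0 ≤ B := by
      obtain ⟨ω⟩ : Nonempty Ω := nonempty_of_isProbabilityMeasure P
      exact (abs_nonneg _).trans (hB (Z 0 ω))
    refine tendsto_coe_ereal_of_forall_eventually fun ε hε => ?_
    obtain ⟨ε₁, hε₁, hCε⟩ : ∃ ε₁ : ℝ, 0 < ε₁ ∧ C * ε₁ ≤ ε / 4 := by
      refine ⟨ε / 4 / (C + 1), by positivity, ?_⟩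
      rw [mul_div_assoc', div_le_iff₀ (by positivity)]
      nlinarith [C.2]
    obtain ⟨η, hη, hBη⟩ : ∃ η : ℝ, 0 < η ∧ 2 * B * η ≤ ε / 4 := by
      refine ⟨ε / 4 / (2 * B + 1), by positivity, ?_⟩
      rw [mul_div_assoc', div_le_iff₀ (by positivity)]
      nlinarith
    have hdist : ∀ᶠ k in (hyperfilter ℕ : Filter ℕ),
        dist (∫ z, ψ z ∂(ν k : Measure E)) (∫ z, ψ z ∂(L : Measure E)) < ε / 4 :=
      Metric.tendsto_nhds.1 (ProbabilityMeasure.tendsto_iff_forall_integral_tendsto.1 hL' ψ')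
        (ε / 4) (by positivity)
    obtain ⟨k, hk1, hk2⟩ := (hdist.and ((happrox ε₁ hε₁ (ENNReal.ofReal η)
      (ENNReal.ofReal_pos.2 hη)).filter_mono hle)).exists
    have hdist2 := Metric.tendsto_nhds.1
      (ProbabilityMeasure.tendsto_iff_forall_integral_tendsto.1 (hconv k) ψ') (ε / 4)
      (by positivity)
    filter_upwards [hk2, hdist2] with n hn1 hn2
    have hmap : ∫ z, ψ' z ∂(Λ k n : Measure E) = ∫ ω, ψ (Y k n ω) ∂P := by
      rw [hΛ]
      exact integral_map (hY k n).aemeasurable hψ.continuous.measurable.aestronglyMeasurable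
    rw [hmap, Real.dist_eq, abs_lt] at hn2
    rw [Real.dist_eq, abs_lt] at hk1
    change -(ε / 4) < _ - ∫ z, ψ z ∂(ν k : Measure E) ∧
      _ - ∫ z, ψ z ∂(ν k : Measure E) < ε / 4 at hn2
    obtain ⟨h1, h2⟩ := outerExpectation_lipschitz_near hψ hB (hY k n) hε₁.le hη.le hn1
    exact ⟨(EReal.coe_le_coe_iff.2 (by linarith [hn2.1, hk1.1])).trans h1,
      h2.trans (EReal.coe_le_coe_iff.2 (by linarith [hn2.2, hk1.2]))⟩
  intro φ
  have hdct : ∀ (ψ : ℕ → E → ℝ) (φ : E →ᵇ ℝ), (∀ m, Continuous (ψ m)) →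
      (∀ m x, |ψ m x| ≤ ‖φ‖) → (∀ x, Tendsto (fun m => ψ m x) atTop (𝓝 (φ x))) →
      Tendsto (fun m => ∫ z, ψ m z ∂(L : Measure E)) atTop (𝓝 (∫ z, φ z ∂(L : Measure E))) := by
    intro ψ φ hc hb ht
    exact tendsto_integral_of_dominated_convergence (fun _ => ‖φ‖)
      (fun m => (hc m).measurable.aestronglyMeasurable) (integrable_const _)
      (fun m => ae_of_all _ fun x => hb m x) (ae_of_all _ ht)
  -- Lipschitz minorants of `φ` and negated Lipschitz minorants of `-φ` bracket `φ` with integrals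
  -- within `ε` of its own; monotonicity of the outer expectation then suffices.
  obtain ⟨ψ, hψl, hψφ, hψb, hψt⟩ := exists_lipschitz_tendsto_of_le φ
  obtain ⟨χ, hχl, hχφ, hχb, hχt⟩ := exists_lipschitz_tendsto_of_le (-φ)
  have hψi := hdct ψ φ (fun m => (hψl m).continuous) hψb hψt
  have hχi := hdct χ (-φ) (fun m => (hχl m).continuous) hχb hχt
  refine tendsto_coe_ereal_of_forall_eventually fun ε hε => ?_
  obtain ⟨m, hm⟩ := (Metric.tendsto_nhds.1 hψi ε hε).exists
  obtain ⟨m', hm'⟩ := (Metric.tendsto_nhds.1 hχi ε hε).exists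
  rw [Real.dist_eq, abs_lt] at hm hm'
  simp only [BoundedContinuousFunction.coe_neg, Pi.neg_apply, integral_neg] at hm'
  have hlo := (hlip (ψ m) _ _ (hψl m) (hψb m)).eventually
    (lt_mem_nhds (EReal.coe_lt_coe_iff.2 (by linarith [hm.1] :
      ∫ z, φ z ∂(L : Measure E) - ε < ∫ z, ψ m z ∂(L : Measure E))))
  have hup := (hlip (fun x => -χ m' x) _ ‖-φ‖ (hχl m').neg
    (fun x => by rw [abs_neg]; exact hχb m' x)).eventually
    (gt_mem_nhds (EReal.coe_lt_coe_iff.2 (by rw [integral_neg]; linarith [hm'.1] :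
      ∫ z, -χ m' z ∂(L : Measure E) < ∫ z, φ z ∂(L : Measure E) + ε)))
  filter_upwards [hlo, hup] with n h1 h2
  refine ⟨h1.le.trans (outerExpectation_mono fun ω => EReal.coe_le_coe_iff.2 (hψφ m _)),
    (outerExpectation_mono fun ω => EReal.coe_le_coe_iff.2 ?_).trans h2.le⟩
  have := hχφ m' (Z n ω)
  simp only [BoundedContinuousFunction.coe_neg, Pi.neg_apply] at this
  linarith

end Approximation

/-! ### Weak convergence in `ℓ^∞(T)` from asymptotic equicontinuity -/

section EllInfty

variable {Ω T : Type*} [MeasurableSpace Ω]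

/-- The step function on `T` with values `x` along a map of `T` into a finite set. -/
def stepFunction {I : Finset T} (c : T → I) (x : I → ℝ) : EllInfty T :=
  ⟨fun t => x (c t), memℓp_infty ⟨‖x‖, by rintro _ ⟨t, rfl⟩; exact norm_le_pi_norm x (c t)⟩⟩

theorem stepFunction_apply {I : Finset T} (c : T → I) (x : I → ℝ) (t : T) :
    stepFunction c x t = x (c t) := rfl

theorem continuous_stepFunction {I : Finset T} (c : T → I) : Continuous (stepFunction c) := by
  refine LipschitzWith.continuous (K := 1) (LipschitzWith.of_dist_le_mul fun x y => ?_)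
  rw [dist_eq_norm, NNReal.coe_one, one_mul]
  refine lp.norm_le_of_forall_le dist_nonneg fun t => ?_
  rw [lp.coeFn_sub, Pi.sub_apply, stepFunction_apply, stepFunction_apply, ← dist_eq_norm]
  exact dist_le_pi_dist x y (c t)

theorem continuous_restrict_ellInfty (I : Finset T) :
    Continuous fun (z : EllInfty T) (t : I) => z t := by
  refine continuous_pi fun t => LipschitzWith.continuous (K := 1)
    (LipschitzWith.of_dist_le_mul fun x y => ?_)
  rw [dist_eq_norm, dist_eq_norm, NNReal.coe_one, one_mul, ← Pi.sub_apply, ← lp.coeFn_sub]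
  exact lp.norm_apply_le_norm ENNReal.top_ne_zero (x - y) t

/-- Asymptotic equicontinuity, total boundedness of the index set and convergence of the
finite-dimensional distributions imply weak convergence in `ℓ^∞(T)` to a tight law. -/
theorem exists_weaklyConverges_of_aec {P : Measure Ω} [IsProbabilityMeasure P]
    {Z : ℕ → Ω → T → ℝ} {τ : T → T → ℝ} (hmeas : ∀ n t, Measurable fun ω => Z n ω t)
    (hZ : ∀ n ω, Memℓp (E := fun _ : T => ℝ) (Z n ω) ∞) (haec : AEC P Z τ)
    (htot : ∀ δ : ℝ, 0 < δ → ∃ I : Finset T, ∀ t, ∃ s ∈ I, τ t s ≤ δ)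
    {m : ∀ I : Finset T, ProbabilityMeasure (I → ℝ)} (hfidi : FidiConverges P Z m) :
    ∃ L : Measure (EllInfty T), IsProbabilityMeasure L ∧ IsTightMeasureSet {L} ∧
      (∀ I : Finset T, L.map (fun z => fun t : I => z t) = (m I : Measure (I → ℝ))) ∧
      WeaklyConverges P (fun n ω => (⟨Z n ω, hZ n ω⟩ : EllInfty T)) L := by
  have hδ : ∀ k : ℕ, (0 : ℝ) < 1 / ((k : ℝ) + 1) := fun k => by positivity
  choose I hI using fun k : ℕ => htot (1 / ((k : ℝ) + 1)) (hδ k)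
  choose c hcI hc using hI
  let c' : ∀ k, T → I k := fun k t => ⟨c k t, hcI k t⟩
  have hvec : ∀ (J : Finset T) n, Measurable fun ω => fun t : J => Z n ω t := fun J n =>
    measurable_pi_lambda _ fun t => hmeas n t
  have hint : ∀ (J : Finset T) (f : (J → ℝ) →ᵇ ℝ),
      Tendsto (fun n => ∫ ω, f (fun t : J => Z n ω t) ∂P) atTop
        (𝓝 (∫ x, f x ∂(m J : Measure (J → ℝ)))) := fun J f => by
    have h := ProbabilityMeasure.tendsto_iff_forall_integral_tendsto.1 (hfidi J).tendsto f
    convert h using 2 with n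
    · exact (integral_map (hvec J n).aemeasurable
        f.continuous.measurable.aestronglyMeasurable).symm
    · rw [ProbabilityMeasure.coe_mk, Measure.map_id']
  -- `Y k n` replaces each value of `Z n` by the value at a net point within `1/(k+1)`; it depends
  -- on finitely many coordinates only, hence is measurable.
  let Y : ℕ → ℕ → Ω → EllInfty T := fun k n ω => stepFunction (c' k) fun t => Z n ω t
  have hY : ∀ k n, Measurable (Y k n) := fun k n =>
    (continuous_stepFunction (c' k)).measurable.comp (hvec (I k) n)
  let ν : ℕ → ProbabilityMeasure (EllInfty T) := fun k =>
    (m (I k)).map (continuous_stepFunction (c' k)).measurable.aemeasurable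
  let Λ : ℕ → ℕ → ProbabilityMeasure (EllInfty T) := fun k n =>
    ⟨P.map (Y k n), Measure.isProbabilityMeasure_map (hY k n).aemeasurable⟩
  have hconv : ∀ k, Tendsto (Λ k) atTop (𝓝 (ν k)) := fun k => by
    refine ProbabilityMeasure.tendsto_iff_forall_integral_tendsto.2 fun g => ?_
    have h := hint (I k) (g.compContinuous ⟨_, continuous_stepFunction (c' k)⟩)
    have hg : ∀ μ : Measure (EllInfty T), AEStronglyMeasurable g μ := fun μ =>
      g.continuous.measurable.aestronglyMeasurable
    have h1 : ∫ z, g z ∂(ν k : Measure (EllInfty T)) =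
        ∫ x, g (stepFunction (c' k) x) ∂(m (I k) : Measure (I k → ℝ)) :=
      integral_map (continuous_stepFunction (c' k)).measurable.aemeasurable (hg _)
    have h2 : ∀ n, ∫ z, g z ∂(Λ k n : Measure (EllInfty T)) = ∫ ω, g (Y k n ω) ∂P := fun n =>
      integral_map (hY k n).aemeasurable (hg _)
    rw [h1]
    exact h.congr fun n => (h2 n).symm
  have htight : ∀ k, IsTightMeasureSet {(ν k : Measure (EllInfty T))} := fun k => by
    have h1 : IsTightMeasureSet {(m (I k) : Measure (I k → ℝ))} := isTightMeasureSet_singleton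
    have h2 := h1.map (continuous_stepFunction (c' k))
    rwa [image_singleton] at h2
  have happrox : ∀ ε : ℝ, 0 < ε → ∀ η : ℝ≥0∞, 0 < η → ∀ᶠ k in atTop, ∀ᶠ n in atTop,
      P {ω | ε < dist (⟨Z n ω, hZ n ω⟩ : EllInfty T) (Y k n ω)} ≤ η := by
    intro ε hε η hη
    have hlim : Tendsto (fun k : ℕ => 1 / ((k : ℝ) + 1)) atTop (𝓝[>] 0) :=
      tendsto_nhdsWithin_iff.2 ⟨tendsto_one_div_add_atTop_nhds_zero_nat,
        Eventually.of_forall hδ⟩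
    filter_upwards [((haec ε hε).comp hlim).eventually (gt_mem_nhds hη)] with k hk
    filter_upwards [eventually_lt_of_limsup_lt hk] with n hn
    refine (measure_mono fun ω hω => ?_).trans hn.le
    obtain ⟨t, ht⟩ : ∃ t, ε < ‖Z n ω t - Z n ω (c k t)‖ := by
      by_contra! hcon
      refine (not_le.2 (show ε < _ from hω)) ?_
      rw [dist_eq_norm]
      exact lp.norm_le_of_forall_le hε.le hcon
    change ENNReal.ofReal ε < _
    refine lt_of_lt_of_le ?_ (le_iSup_of_le t (le_iSup_of_le (c k t)
      (le_iSup_of_le (hc k t) le_rfl)))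
    rw [← ofReal_norm]
    exact (ENNReal.ofReal_lt_ofReal_iff_of_nonneg hε.le).2 ht
  obtain ⟨L, hL, hLw⟩ := exists_weak_limit_of_approximation (P := P)
    (fun n ω => (⟨Z n ω, hZ n ω⟩ : EllInfty T)) Y hY ν htight Λ (fun k n => rfl) hconv happrox
  refine ⟨L, inferInstance, hL, fun J => ?_, hLw⟩
  have hres := continuous_restrict_ellInfty J
  have := Measure.isProbabilityMeasure_map (μ := (L : Measure (EllInfty T)))
    hres.measurable.aemeasurable
  refine ext_of_forall_integral_eq_of_IsFiniteMeasure fun f => ?_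
  rw [integral_map hres.measurable.aemeasurable f.continuous.measurable.aestronglyMeasurable]
  have h1 := hLw (f.compContinuous ⟨_, hres⟩)
  -- Finitely many coordinates are measurable, so here the outer expectation is an ordinary one and
  -- uniqueness of limits identifies the marginal.
  have h3 : ∀ n, outerExpectation P (fun ω => ((f fun t : J => Z n ω t : ℝ) : EReal)) =
      ((∫ ω, f (fun t : J => Z n ω t) ∂P : ℝ) : EReal) := fun n => by
    have hm : Measurable fun ω => f fun t : J => Z n ω t :=
      f.continuous.measurable.comp (hvec J n)
    exact outerExpectation_coe_real hm (Integrable.of_bound hm.aestronglyMeasurable ‖f‖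
      (ae_of_all _ fun ω => f.norm_coe_le_norm _))
  have h4 : Tendsto (fun n => ∫ ω, f (fun t : J => Z n ω t) ∂P) atTop
      (𝓝 (∫ z : EllInfty T, f (fun t : J => z t) ∂(L : Measure (EllInfty T)))) := by
    rw [← EReal.tendsto_coe]
    exact h1.congr h3
  exact tendsto_nhds_unique h4 (hint J f)

end EllInfty

/-! ### The maximal inequality under a growth condition -/

section Maximal

/-- The constant in the maximal inequality under a growth condition. -/
def maximalConst (ν α Q : ℝ) : ℝ := (1 - (2 * (Q / 2) ^ α) ^ (1 / ν))⁻¹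

/-- The upper limit on `Q` amounts to `Q ^ α < 2 ^ (α - 1)`, which is exactly what makes the
recursion of the maximal inequality a contraction. -/
theorem two_mul_half_rpow_lt_one {α Q : ℝ} (hα : 1 < α) (hQ1 : 1 ≤ Q)
    (hQ : Q < (2 : ℝ) ^ ((α - 1) / α)) : 2 * (Q / 2) ^ α < 1 := by
  have hα0 : 0 < α := by linarith
  have h1 : Q ^ α < (2 : ℝ) ^ (α - 1) := by
    have := Real.rpow_lt_rpow (by linarith) hQ hα0
    rwa [← Real.rpow_mul (by norm_num), div_mul_cancel₀ _ hα0.ne'] at this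
  have h2 : (0 : ℝ) < 2 ^ α := by positivity
  rw [Real.rpow_sub (by norm_num), Real.rpow_one, lt_div_iff₀ (by norm_num)] at h1
  rw [Real.div_rpow (by linarith) (by norm_num), mul_div_assoc', div_lt_one h2]
  linarith

/-- The constant is the fixed point of `K ↦ 1 + K θ` with `θ = (2 (Q/2)^α)^{1/ν} < 1`, so it
reproduces itself in the induction step. -/
theorem one_add_maximalConst_mul {ν α Q : ℝ} (hν : 0 < ν) (hα : 1 < α) (hQ1 : 1 ≤ Q)
    (hQ : Q < (2 : ℝ) ^ ((α - 1) / α)) :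
    0 < maximalConst ν α Q ∧
      1 + maximalConst ν α Q * (2 * (Q / 2) ^ α) ^ (1 / ν) = maximalConst ν α Q := by
  have h0 : 0 ≤ 2 * (Q / 2) ^ α := by positivity
  have h1 : (2 * (Q / 2) ^ α) ^ (1 / ν) < 1 :=
    Real.rpow_lt_one h0 (two_mul_half_rpow_lt_one hα hQ1 hQ) (by positivity)
  unfold maximalConst
  have h2 : 0 < 1 - (2 * (Q / 2) ^ α) ^ (1 / ν) := by linarith
  exact ⟨inv_pos.2 h2, by field_simp; ring⟩

/-- The induction step in `L^ν`. Since the `ν`-th power of a maximum is at most the sum of the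
powers, the maximum has norm at most `K θ G^{α/ν}`; Minkowski's inequality adds `G^{α/ν}` for `V`,
and `1 + K θ = K`. -/
theorem lintegral_add_max_rpow_le {Ω : Type*} [MeasurableSpace Ω] {P : Measure Ω}
    {ν α Q G : ℝ} (hν : 1 ≤ ν) (hα : 1 < α) (hQ1 : 1 ≤ Q) (hQ : Q < (2 : ℝ) ^ ((α - 1) / α))
    (hG : 0 ≤ G) {V W₁ W₂ : Ω → ℝ≥0∞} (hV : Measurable V) (hW₁ : Measurable W₁)
    (hW₂ : Measurable W₂) (h : ∫⁻ ω, V ω ^ ν ∂P ≤ ENNReal.ofReal (G ^ α))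
    (h₁ : ∫⁻ ω, W₁ ω ^ ν ∂P ≤ ENNReal.ofReal (maximalConst ν α Q ^ ν * (Q / 2 * G) ^ α))
    (h₂ : ∫⁻ ω, W₂ ω ^ ν ∂P ≤ ENNReal.ofReal (maximalConst ν α Q ^ ν * (Q / 2 * G) ^ α)) :
    ∫⁻ ω, (V ω + max (W₁ ω) (W₂ ω)) ^ ν ∂P ≤
      ENNReal.ofReal (maximalConst ν α Q ^ ν * G ^ α) := by
  have hν0 : 0 < ν := by linarith
  obtain ⟨hK, hKθ⟩ := one_add_maximalConst_mul hν0 hα hQ1 hQ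
  set K := maximalConst ν α Q
  have hmax : ∫⁻ ω, (max (W₁ ω) (W₂ ω)) ^ ν ∂P ≤
      ENNReal.ofReal (2 * (K ^ ν * (Q / 2 * G) ^ α)) := by
    have hle : ∀ ω, (max (W₁ ω) (W₂ ω)) ^ ν ≤ W₁ ω ^ ν + W₂ ω ^ ν := by
      intro ω
      rcases le_total (W₁ ω) (W₂ ω) with hle | hle
      · rw [max_eq_right hle]; exact le_add_self
      · rw [max_eq_left hle]; exact le_self_add
    refine (lintegral_mono hle).trans ?_
    rw [lintegral_add_left (hW₁.pow_const ν), two_mul,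
      ENNReal.ofReal_add (by positivity) (by positivity)]
    exact add_le_add h₁ h₂
  have hmink := ENNReal.lintegral_Lp_add_le (μ := P) (p := ν) hV.aemeasurable
    (hW₁.max hW₂).aemeasurable hν
  have hbound : (∫⁻ ω, (V ω + max (W₁ ω) (W₂ ω)) ^ ν ∂P) ^ (1 / ν) ≤
      ENNReal.ofReal (K * G ^ (α / ν)) := by
    refine hmink.trans ?_
    calc (∫⁻ ω, V ω ^ ν ∂P) ^ (1 / ν) + (∫⁻ ω, (max (W₁ ω) (W₂ ω)) ^ ν ∂P) ^ (1 / ν)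
        ≤ ENNReal.ofReal (G ^ α) ^ (1 / ν) +
            ENNReal.ofReal (2 * (K ^ ν * (Q / 2 * G) ^ α)) ^ (1 / ν) := by gcongr
      _ = ENNReal.ofReal ((G ^ α) ^ (1 / ν) + (2 * (K ^ ν * (Q / 2 * G) ^ α)) ^ (1 / ν)) := by
          rw [ENNReal.ofReal_rpow_of_nonneg (by positivity) (by positivity),
            ENNReal.ofReal_rpow_of_nonneg (by positivity) (by positivity),
            ENNReal.ofReal_add (by positivity) (by positivity)]
      _ = ENNReal.ofReal (K * G ^ (α / ν)) := by
          congr 1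
          have e1 : (G ^ α) ^ (1 / ν) = G ^ (α / ν) := by
            rw [← Real.rpow_mul hG]; congr 1; ring
          have e2 : (2 * (K ^ ν * (Q / 2 * G) ^ α)) ^ (1 / ν) =
              K * (2 * (Q / 2) ^ α) ^ (1 / ν) * G ^ (α / ν) := by
            rw [Real.mul_rpow (by positivity) hG,
              show 2 * (K ^ ν * ((Q / 2) ^ α * G ^ α)) = K ^ ν * (2 * (Q / 2) ^ α) * G ^ α by ring,
              Real.mul_rpow (by positivity) (by positivity),
              Real.mul_rpow (by positivity) (by positivity), e1, ← Real.rpow_mul hK.le,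
              mul_one_div_cancel hν0.ne', Real.rpow_one]
          rw [e1, e2]
          linear_combination G ^ (α / ν) * hKθ
  have hpow := ENNReal.rpow_le_rpow hbound hν0.le
  rw [← ENNReal.rpow_mul, one_div_mul_cancel hν0.ne', ENNReal.rpow_one,
    ENNReal.ofReal_rpow_of_nonneg (by positivity) hν0.le,
    Real.mul_rpow hK.le (by positivity), ← Real.rpow_mul hG, div_mul_cancel₀ _ hν0.ne'] at hpow
  exact hpow

/-- Maximal inequality: moment bounds for partial sums that satisfy a growth condition are inherited,
up to a constant, by the maximum of the partial sums. -/
theorem exists_measurable_maximal {Ω ι : Type*} [MeasurableSpace Ω] {P : Measure Ω}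
    {ν α Q : ℝ} (hν : 1 ≤ ν) (hα : 1 < α) {g : ℕ → ℝ} (hg : GrowthCondition α g Q) {N : ℕ}
    (y : ℕ → ι → Ω → ℝ)
    (h : ∀ i j, 1 ≤ i → i ≤ j → j ≤ N → ∃ V : Ω → ℝ≥0∞, Measurable V ∧
      (∀ φ ω, ‖∑ k ∈ Finset.Icc i j, y k φ ω‖ₑ ≤ V ω) ∧
      ∫⁻ ω, V ω ^ ν ∂P ≤ ENNReal.ofReal (g (j - i + 1) ^ α)) (m : ℕ) :
    ∀ i, 1 ≤ i → 1 ≤ m → i + m ≤ N + 1 → ∃ W : Ω → ℝ≥0∞, Measurable W ∧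
      (∀ φ ω l, l ≤ m → ‖∑ k ∈ Finset.Ico i (i + l), y k φ ω‖ₑ ≤ W ω) ∧
      ∫⁻ ω, W ω ^ ν ∂P ≤ ENNReal.ofReal (maximalConst ν α Q ^ ν * g m ^ α) := by
  have hν0 : 0 < ν := by linarith
  have hα0 : 0 < α := by linarith
  have hQ0 : 0 < Q := by linarith [hg.one_le]
  have hQ2 : Q ≤ 2 := by
    refine hg.lt.le.trans ?_
    calc (2 : ℝ) ^ ((α - 1) / α) ≤ 2 ^ (1 : ℝ) :=
          Real.rpow_le_rpow_of_exponent_le (by norm_num) ((div_le_one hα0).2 (by linarith))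
      _ = 2 := Real.rpow_one 2
  have hK := (one_add_maximalConst_mul hν0 hα hg.one_le hg.lt).1
  induction m using Nat.strong_induction_on with
  | _ m ih =>
  intro i hi hm hN
  have hG := hg.nonneg m hm
  have hex : ∃ p, 1 ≤ p ∧ Q / 2 * g m ≤ g p := ⟨m, hm, by nlinarith⟩
  classical
  -- Split at the first `p` where `g` reaches `Q/2 * g m`; since `Q ≤ 2`, `m` itself qualifies.
  -- Below `p` minimality bounds `g (p - 1)`, and beyond it the growth condition gives `g (m - p) ≤
  -- Q * g m - g p ≤ Q/2 * g m`.
  obtain ⟨p, ⟨hp1, hpg⟩, hpmin⟩ : ∃ p, (1 ≤ p ∧ Q / 2 * g m ≤ g p) ∧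
      ∀ q < p, ¬ (1 ≤ q ∧ Q / 2 * g m ≤ g q) :=
    ⟨Nat.find hex, Nat.find_spec hex, fun q hq => Nat.find_min hex hq⟩
  have hpm : p ≤ m := by
    by_contra! hlt
    exact hpmin m hlt ⟨hm, by nlinarith⟩
  have hsub : ∀ i' m', 1 ≤ i' → m' < m → i' + m' ≤ N + 1 → (1 ≤ m' → g m' ≤ Q / 2 * g m) →
      ∃ W : Ω → ℝ≥0∞, Measurable W ∧
        (∀ φ ω l, l ≤ m' → ‖∑ k ∈ Finset.Ico i' (i' + l), y k φ ω‖ₑ ≤ W ω) ∧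
        ∫⁻ ω, W ω ^ ν ∂P ≤
          ENNReal.ofReal (maximalConst ν α Q ^ ν * (Q / 2 * g m) ^ α) := by
    intro i' m' hi' hm' hN' hgm'
    -- Either piece may be empty, and the growth condition says nothing about `g 0`.
    rcases Nat.eq_zero_or_pos m' with rfl | hpos
    · refine ⟨fun _ => 0, measurable_const, fun φ ω l hl => ?_, ?_⟩
      · rw [Nat.le_zero.1 hl]; simp
      · simp [ENNReal.zero_rpow_of_pos hν0]
    · obtain ⟨W, hWm, hW, hWi⟩ := ih m' hm' i' hi' hpos hN'
      refine ⟨W, hWm, hW, hWi.trans (ENNReal.ofReal_le_ofReal ?_)⟩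
      have := Real.rpow_le_rpow (hg.nonneg m' hpos) (hgm' hpos) hα0.le
      gcongr
  obtain ⟨W₁, hW₁m, hW₁, hW₁i⟩ := hsub i (p - 1) hi (by omega) (by omega) fun h1 => by
    by_contra! hlt
    exact hpmin (p - 1) (by omega) ⟨h1, hlt.le⟩
  obtain ⟨W₂, hW₂m, hW₂, hW₂i⟩ := hsub (i + p) (m - p) (by omega) (by omega) (by omega)
    fun h1 => by
      have := hg.add_le p m hp1 (by omega)
      linarith
  obtain ⟨V, hVm, hV, hVi⟩ := h i (i + p - 1) hi (by omega) (by omega)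
  refine ⟨fun ω => V ω + max (W₁ ω) (W₂ ω), hVm.add (hW₁m.max hW₂m), fun φ ω l hl => ?_,
    lintegral_add_max_rpow_le hν hα hg.one_le hg.lt hG hVm hW₁m hW₂m
      (hVi.trans (ENNReal.ofReal_le_ofReal ?_)) hW₁i hW₂i⟩
  · rcases Nat.lt_or_ge l p with hlp | hlp
    · exact (hW₁ φ ω l (by omega)).trans ((le_max_left _ _).trans le_add_self)
    · rw [← Finset.sum_Ico_consecutive _ (show i ≤ i + p by omega) (show i + p ≤ i + l by omega)]
      refine (enorm_add_le _ _).trans (add_le_add ?_ ((?_ : _ ≤ W₂ ω).trans (le_max_right _ _)))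
      · have := hV φ ω
        rwa [show Finset.Icc i (i + p - 1) = Finset.Ico i (i + p) by ext; simp; omega] at this
      · have := hW₂ φ ω (l - p) (by omega)
        rwa [show i + p + (l - p) = i + l by omega] at this
  · rw [show i + p - 1 - i + 1 = p by omega]
    exact Real.rpow_le_rpow (hg.nonneg p hp1) (hg.mono p m hp1 hpm) hα0.le

end Maximal

/-! ### Oscillation of interpolated partial sums, and intervals close in measure -/

section Interpolation

/-- Abel summation: a sum with antitone weights in `[0, 1]` is bounded by the largest partial
sum. -/
theorem abs_sum_range_mul_le {w x : ℕ → ℝ} {a : ℝ} {m : ℕ} (hw : Antitone w)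
    (hw0 : ∀ i, 0 ≤ w i) (hw1 : w 0 ≤ 1) (h : ∀ l ≤ m, |∑ i ∈ Finset.range l, x i| ≤ a) :
    |∑ i ∈ Finset.range m, w i * x i| ≤ a := by
  have ha : 0 ≤ a := (abs_nonneg _).trans (h 0 (Nat.zero_le _))
  have key : ∀ k ≤ m, |∑ i ∈ Finset.range k, w i * x i - w k * ∑ i ∈ Finset.range k, x i| ≤
      (w 0 - w k) * a := by
    intro k
    induction k with
    | zero => simp
    | succ k ih =>
      intro hk
      have h1 := ih (by omega)
      have h2 : |(w k - w (k + 1)) * ∑ i ∈ Finset.range (k + 1), x i| ≤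
          (w k - w (k + 1)) * a := by
        have h3 : 0 ≤ w k - w (k + 1) := sub_nonneg.2 (hw k.le_succ)
        rw [abs_mul, abs_of_nonneg h3]
        exact mul_le_mul_of_nonneg_left (h _ hk) h3
      have h4 : ∑ i ∈ Finset.range (k + 1), w i * x i -
          w (k + 1) * ∑ i ∈ Finset.range (k + 1), x i =
          (∑ i ∈ Finset.range k, w i * x i - w k * ∑ i ∈ Finset.range k, x i) +
            (w k - w (k + 1)) * ∑ i ∈ Finset.range (k + 1), x i := by
        simp only [Finset.sum_range_succ]; ring
      rw [h4]
      exact (abs_add_le _ _).trans (by linarith)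
  have h1 := key m le_rfl
  have h2 : |w m * ∑ i ∈ Finset.range m, x i| ≤ w m * a := by
    rw [abs_mul, abs_of_nonneg (hw0 m)]
    exact mul_le_mul_of_nonneg_left (h m le_rfl) (hw0 m)
  have h3 := abs_add_le (∑ i ∈ Finset.range m, w i * x i - w m * ∑ i ∈ Finset.range m, x i)
    (w m * ∑ i ∈ Finset.range m, x i)
  rw [sub_add_cancel] at h3
  have h4 : w 0 * a ≤ 1 * a := mul_le_mul_of_nonneg_right hw1 ha
  linarith

/-- Truncation to the unit interval. -/
def unitClamp (s : ℝ) : ℝ := max 0 (min 1 s)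

theorem unitClamp_nonneg (s : ℝ) : 0 ≤ unitClamp s := le_max_left _ _

theorem unitClamp_le_one (s : ℝ) : unitClamp s ≤ 1 := max_le zero_le_one (min_le_left _ _)

theorem unitClamp_of_nonpos {s : ℝ} (hs : s ≤ 0) : unitClamp s = 0 := by
  rw [unitClamp, min_eq_right (by linarith), max_eq_left hs]

theorem unitClamp_of_one_le {s : ℝ} (hs : 1 ≤ s) : unitClamp s = 1 := by
  rw [unitClamp, min_eq_left hs, max_eq_right zero_le_one]

theorem unitClamp_mono : Monotone unitClamp := fun _ _ h =>
  max_le_max le_rfl (min_le_min le_rfl h)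

/-- The linear interpolation at `t ∈ [0, n]` of the partial sums of `x 1, …, x n`. -/
def interpolation (n : ℕ) (x : ℕ → ℝ) (t : ℝ) : ℝ :=
  ∑ i ∈ Finset.Icc 1 n, unitClamp (t - ((i : ℝ) - 1)) * x i

/-- For `t ≥ 0`, `unitClamp (t - (i - 1))` is the share of the cell `(i - 1, i]` lying below `t`.
This turns the interval weights into increments of the interpolation. -/
theorem volume_real_cell_inter (n : ℕ) (hn : 0 < n) (i : ℝ) {u v : ℝ} (huv : u ≤ v) :
    volume.real (Ioc (i - 1) i ∩ (n : ℝ) • Ioc u v) =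
      unitClamp (n * v - (i - 1)) - unitClamp (n * u - (i - 1)) := by
  have hn' : (0 : ℝ) < n := by exact_mod_cast hn
  rw [LinearOrderedField.smul_Ioc hn', Ioc_inter_Ioc, Real.volume_real_Ioc]
  have h : (n : ℝ) * u ≤ n * v := mul_le_mul_of_nonneg_left huv hn'.le
  simp only [unitClamp]
  grind

theorem sum_volume_mul_eq (n : ℕ) (x : ℕ → ℝ) {u v : ℝ} (huv : u ≤ v) :
    ∑ i ∈ Finset.Icc 1 n, volume.real (Ioc ((i : ℝ) - 1) (i : ℝ) ∩ (n : ℝ) • Ioc u v) * x i =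
      interpolation n x (n * v) - interpolation n x (n * u) := by
  rw [interpolation, interpolation, ← Finset.sum_sub_distrib]
  refine Finset.sum_congr rfl fun i hi => ?_
  rw [Finset.mem_Icc] at hi
  rw [volume_real_cell_inter n (by omega) _ huv, sub_mul]

/-- Cells up to `a` have weight one at both times and cells beyond `a + m` weight zero, so both
cancel. On the remaining cells the weights at `t` decrease in `i`, and Abel summation applies. -/
theorem abs_interpolation_sub_nat_le {n a m : ℕ} {x : ℕ → ℝ} {t M : ℝ} (ham : a + m ≤ n)
    (hat : (a : ℝ) ≤ t) (htm : t ≤ a + m)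
    (h : ∀ l ≤ m, |∑ k ∈ Finset.Ico (a + 1) (a + 1 + l), x k| ≤ M) :
    |interpolation n x t - interpolation n x a| ≤ M := by
  have h1 : interpolation n x t - interpolation n x a =
      ∑ i ∈ Finset.Ico (a + 1) (a + 1 + m), unitClamp (t - ((i : ℝ) - 1)) * x i := by
    rw [interpolation, interpolation, ← Finset.sum_sub_distrib]
    symm
    refine Finset.sum_subset_zero_on_sdiff (fun i hi => ?_) (fun i hi => ?_) (fun i hi => ?_)
    · simp only [Finset.mem_Ico, Finset.mem_Icc] at hi ⊢; omega
    · simp only [Finset.mem_sdiff, Finset.mem_Icc, Finset.mem_Ico, not_and, not_lt] at hi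
      rcases Nat.lt_or_ge a i with hai | hai
      · have h2 : (a : ℝ) + 1 + m ≤ i := by exact_mod_cast hi.2 hai
        have h3 : (0 : ℝ) ≤ m := Nat.cast_nonneg m
        rw [unitClamp_of_nonpos (by linarith), unitClamp_of_nonpos (by linarith), sub_self]
      · have h2 : (i : ℝ) ≤ a := by exact_mod_cast hai
        rw [unitClamp_of_one_le (by linarith), unitClamp_of_one_le (by linarith), sub_self]
    · rw [Finset.mem_Ico] at hi
      have h2 : (a : ℝ) + 1 ≤ i := by exact_mod_cast hi.1
      rw [unitClamp_of_nonpos (show (a : ℝ) - (i - 1) ≤ 0 by linarith), zero_mul, sub_zero]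
  rw [h1, Finset.sum_Ico_eq_sum_range, Nat.add_sub_cancel_left]
  refine abs_sum_range_mul_le (w := fun j => unitClamp (t - (((a + 1 + j : ℕ) : ℝ) - 1)))
    (x := fun j => x (a + 1 + j)) (fun j k hjk => unitClamp_mono ?_)
    (fun j => unitClamp_nonneg _) (unitClamp_le_one _) (fun l hl => ?_)
  · have : ((a + 1 + j : ℕ) : ℝ) ≤ ((a + 1 + k : ℕ) : ℝ) := by exact_mod_cast (by omega)
    linarith
  · have := h l hl
    rwa [Finset.sum_Ico_eq_sum_range, Nat.add_sub_cancel_left] at this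

theorem abs_interpolation_sub_block_le {n r b : ℕ} {x : ℕ → ℝ} {M : ℝ}
    (h : ∀ b l, l ≤ r → b * r + l ≤ n →
      |∑ k ∈ Finset.Ico (b * r + 1) (b * r + 1 + l), x k| ≤ M) {t : ℝ}
    (hbt : (b : ℝ) * r ≤ t) (htb : t ≤ (b + 1) * r) (htn : t ≤ n) :
    |interpolation n x t - interpolation n x (b * r)| ≤ M := by
  have hbn : b * r ≤ n := by exact_mod_cast hbt.trans htn
  -- The last block may be cut off by `n`, whence the length `min r (n - b * r)`.
  have := abs_interpolation_sub_nat_le (n := n) (a := b * r) (m := min r (n - b * r)) (x := x)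
    (t := t) (M := M) (by omega) (by push_cast; exact hbt) ?_ fun l hl =>
      h b l (hl.trans (min_le_left _ _)) (by omega)
  · push_cast at this; exact this
  · rcases le_total r (n - b * r) with hle | hle
    · rw [min_eq_left hle]; push_cast; linarith
    · rw [min_eq_right hle, Nat.cast_sub hbn]; push_cast; linarith

/-- If the partial sums over all blocks of length `r` are bounded by `M`, then the interpolation
varies by at most `3 M` over distances up to `r`. -/
theorem abs_interpolation_sub_le {n r : ℕ} (hr : 0 < r) {x : ℕ → ℝ} {M : ℝ}
    (h : ∀ b l, l ≤ r → b * r + l ≤ n →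
      |∑ k ∈ Finset.Ico (b * r + 1) (b * r + 1 + l), x k| ≤ M) {s t : ℝ}
    (hs : 0 ≤ s) (hsn : s ≤ n) (ht : 0 ≤ t) (htn : t ≤ n) (hst : |t - s| ≤ r) :
    |interpolation n x t - interpolation n x s| ≤ 3 * M := by
  wlog hle : s ≤ t generalizing s t
  · rw [abs_sub_comm]
    exact this ht htn hs hsn (by rwa [abs_sub_comm]) (le_of_not_ge hle)
  have hM : 0 ≤ M := (abs_nonneg _).trans (h 0 0 (by omega) (by omega))
  have hr' : (0 : ℝ) < r := by exact_mod_cast hr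
  set b := ⌊s / r⌋₊ with hb
  have hb1 : (b : ℝ) * r ≤ s := by
    have := Nat.floor_le (div_nonneg hs hr'.le)
    rwa [le_div_iff₀ hr'] at this
  have hb2 : s ≤ (b + 1) * r := by
    have := (Nat.lt_floor_add_one (s / r)).le
    rwa [div_le_iff₀ hr'] at this
  have hts : t ≤ s + r := by linarith [le_of_abs_le hst]
  have h1 := abs_interpolation_sub_block_le h hb1 hb2 hsn
  rw [abs_le] at h1
  -- Since `t ≤ s + r`, the points lie in the same block or in adjacent ones: two comparisons with
  -- the left end of the block, or three through the common end point.
  rcases le_total t ((b + 1) * r) with hcase | hcase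
  · have h2 := abs_interpolation_sub_block_le h (hb1.trans hle) hcase htn
    rw [abs_le] at h2 ⊢
    constructor <;> linarith
  · have h2 := abs_interpolation_sub_block_le (b := b) h (by nlinarith) le_rfl (hcase.trans htn)
    have h3 := abs_interpolation_sub_block_le (b := b + 1) h (by push_cast; exact hcase)
      (by push_cast; nlinarith) htn
    push_cast at h3
    rw [abs_le] at h2 h3 ⊢
    constructor <;> linarith

/-- Two intervals with a small symmetric difference have close end points or are both short. -/
theorem endpoints_close_or_short {u v u' v' : ℝ} (huv : u ≤ v) (huv' : u' ≤ v') {D : ℝ}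
    (hD : volume.real (Ioc u v ∆ Ioc u' v') ≤ D) :
    (|u - u'| ≤ D ∧ |v - v'| ≤ D) ∨ (v - u ≤ D ∧ v' - u' ≤ D) := by
  have hfin : volume (Ioc u v ∆ Ioc u' v') ≠ ⊤ :=
    ((measure_mono symmDiff_le_sup).trans_lt
      ((measure_union_le _ _).trans_lt (by simp [ENNReal.add_lt_top]))).ne
  have key : ∀ {a b : ℝ}, a ≤ b → Ioc a b ⊆ Ioc u v ∆ Ioc u' v' → b - a ≤ D := by
    intro a b hab hsub
    have := (measureReal_mono hsub hfin).trans hD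
    rwa [Real.volume_real_Ioc_of_le hab] at this
  -- Intervals that do not overlap lie entirely in the symmetric difference; if they overlap, the
  -- gaps between corresponding end points do.
  by_cases hdisj : v ≤ u' ∨ v' ≤ u
  · right
    constructor
    · refine key huv fun z hz => Or.inl ⟨hz, fun hz' => ?_⟩
      rcases hdisj with h | h <;> linarith [hz.1, hz.2, hz'.1, hz'.2]
    · refine key huv' fun z hz => Or.inr ⟨hz, fun hz' => ?_⟩
      rcases hdisj with h | h <;> linarith [hz.1, hz.2, hz'.1, hz'.2]
  · push Not at hdisj
    left
    constructor
    · rcases le_total u u' with h | h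
      · rw [abs_sub_comm, abs_of_nonneg (sub_nonneg.2 h)]
        refine key h fun z hz => Or.inl ⟨⟨hz.1, hz.2.trans hdisj.1.le⟩, fun hz' => ?_⟩
        linarith [hz.2, hz'.1]
      · rw [abs_of_nonneg (sub_nonneg.2 h)]
        refine key h fun z hz => Or.inr ⟨⟨hz.1, hz.2.trans hdisj.2.le⟩, fun hz' => ?_⟩
        linarith [hz.2, hz'.1]
    · rcases le_total v v' with h | h
      · rw [abs_sub_comm, abs_of_nonneg (sub_nonneg.2 h)]
        refine key h fun z hz => Or.inr ⟨⟨hdisj.1.trans hz.1, hz.2⟩, fun hz' => ?_⟩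
        linarith [hz.1, hz'.2]
      · rw [abs_of_nonneg (sub_nonneg.2 h)]
        refine key h fun z hz => Or.inl ⟨⟨hdisj.2.trans hz.1, hz.2⟩, fun hz' => ?_⟩
        linarith [hz.1, hz'.2]

end Interpolation

/-! ### Asymptotic equicontinuity of the smoothed process -/

section Equicontinuity

variable {Ω 𝓧 : Type*} [MeasurableSpace Ω] {P : Measure Ω} {X : ℕ → ℕ → Ω → 𝓧}

theorem centered_sub {f g : 𝓧 → ℝ} {n i : ℕ} (hf : Integrable (fun ω => f (X n i ω)) P)
    (hg : Integrable (fun ω => g (X n i ω)) P) (ω : Ω) :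
    centered P X n i (f - g) ω = centered P X n i f ω - centered P X n i g ω := by
  simp only [centered, Pi.sub_apply]
  rw [integral_sub hf hg]
  ring

theorem smoothedProcess_Ioc (n : ℕ) (ω : Ω) {u v : ℝ} (huv : u ≤ v) (f : 𝓧 → ℝ) :
    smoothedProcess P X n ω (Ioc u v) f =
      (1 / √(n : ℝ)) * (interpolation n (fun i => centered P X n i f ω) (n * v) -
        interpolation n (fun i => centered P X n i f ω) (n * u)) := by
  rw [smoothedProcess, sum_volume_mul_eq n (fun i => centered P X n i f ω) huv]

/-- The `ν`-th root of a measurable majorant of the supremum bounds all partial sums of the class at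
once, so the maximal inequality applies uniformly in `φ`. -/
theorem exists_maximal_of_outerMoment {H : Set (𝓧 → ℝ)} {ν Q : ℝ} (hν : 2 < ν) {g : ℕ → ℝ}
    (hg : GrowthCondition (ν / 2) g Q) {n : ℕ}
    (h : ∀ i j, 1 ≤ i → i ≤ j → j ≤ n →
      outerMoment P X H ν n i j ≤ ((g (j - i + 1) ^ (ν / 2) : ℝ) : EReal))
    {i m : ℕ} (hi : 1 ≤ i) (hm : 1 ≤ m) (him : i + m ≤ n + 1) :
    ∃ W : Ω → ℝ≥0∞, Measurable W ∧
      (∀ φ ∈ H, ∀ ω, ∀ l ≤ m, ‖∑ k ∈ Finset.Ico i (i + l), centered P X n k φ ω‖ₑ ≤ W ω) ∧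
      ∫⁻ ω, W ω ^ ν ∂P ≤ ENNReal.ofReal (maximalConst ν (ν / 2) Q ^ ν * g m ^ (ν / 2)) := by
  have hν0 : 0 < ν := by linarith
  obtain ⟨W, hWm, hW, hWi⟩ := exists_measurable_maximal (P := P) (N := n) (by linarith)
    (by linarith) hg (fun k (φ : H) ω => centered P X n k φ ω) (fun i j hi hij hjn => by
      obtain ⟨U, hUm, hU, hUi⟩ := exists_measurable_majorant (h i j hi hij hjn)
      refine ⟨fun ω => U ω ^ (1 / ν), hUm.pow_const _, fun φ ω => ?_, ?_⟩
      · have h1 := (le_iSup₂_of_le (f := fun (φ : 𝓧 → ℝ) (_ : φ ∈ H) =>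
          ‖partialSum P X n i j φ ω‖ₑ ^ ν) φ.1 φ.2 le_rfl).trans (hU ω)
        have h2 := ENNReal.rpow_le_rpow h1 (by positivity : 0 ≤ 1 / ν)
        rwa [← ENNReal.rpow_mul, mul_one_div_cancel hν0.ne', ENNReal.rpow_one] at h2
      · simp only [← ENNReal.rpow_mul, one_div_mul_cancel hν0.ne', ENNReal.rpow_one]
        exact hUi) m i hi hm him
  exact ⟨W, hWm, fun φ hφ ω l hl => hW ⟨φ, hφ⟩ ω l hl, hWi⟩

theorem measure_ofReal_le_of_lintegral_rpow_le {W : Ω → ℝ≥0∞} (hW : Measurable W) {ν a c : ℝ}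
    (hν : 0 < ν) (ha : 0 < a) (hc : ∫⁻ ω, W ω ^ ν ∂P ≤ ENNReal.ofReal c) :
    P {ω | ENNReal.ofReal a ≤ W ω} ≤ ENNReal.ofReal (c / a ^ ν) := by
  have h1 := mul_meas_ge_le_lintegral₀ (μ := P) (hW.pow_const ν).aemeasurable
    (ENNReal.ofReal (a ^ ν))
  have h2 : {ω | ENNReal.ofReal a ≤ W ω} ⊆ {ω | ENNReal.ofReal (a ^ ν) ≤ W ω ^ ν} := by
    intro ω hω
    have := ENNReal.rpow_le_rpow (show ENNReal.ofReal a ≤ W ω from hω) hν.le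
    rwa [ENNReal.ofReal_rpow_of_nonneg ha.le hν.le] at this
  have ha' : 0 < a ^ ν := by positivity
  rw [ENNReal.ofReal_div_of_pos ha', ENNReal.le_div_iff_mul_le
    (Or.inl (ENNReal.ofReal_pos.2 ha').ne') (Or.inl ENNReal.ofReal_ne_top), mul_comm]
  exact (mul_le_mul_right (measure_mono h2) _).trans (h1.trans hc)

theorem div_scaled_rpow {ν ε K G : ℝ} {n : ℕ} (hε : 0 < ε) (hG : 0 ≤ G) :
    K * G ^ (ν / 2) / (ε * √(n : ℝ) / 8) ^ ν = K * (8 / ε) ^ ν * (G / n) ^ (ν / 2) := by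
  rw [show ε * √(n : ℝ) / 8 = √(n : ℝ) * (8 / ε)⁻¹ by rw [inv_div]; ring,
    Real.mul_rpow (by positivity) (by positivity), Real.inv_rpow (by positivity),
    Real.div_rpow hG (by positivity), Real.sqrt_eq_rpow, ← Real.rpow_mul (by positivity),
    show 1 / 2 * ν = ν / 2 by ring]
  have : (8 / ε) ^ ν ≠ 0 := by positivity
  field_simp

variable [MeasurableSpace 𝓧] {F : Set (𝓧 → ℝ)}

theorem HasEnvelope.integrable (hEnv : HasEnvelope P X F)
    (hX : ∀ n i, 1 ≤ i → i ≤ n → Measurable (X n i)) (hF : ∀ f ∈ F, Measurable f)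
    {f : 𝓧 → ℝ} (hf : f ∈ F) {n i : ℕ} (hi : 1 ≤ i) (hin : i ≤ n) :
    Integrable (fun ω => f (X n i ω)) P := by
  obtain ⟨G, -, hG, hint⟩ := hEnv
  exact (hint n i hi hin).mono' ((hF f hf).comp (hX n i hi hin)).aestronglyMeasurable
    (ae_of_all _ fun ω => hG f hf _)

/-- Bounds for the partial sums of the increments and for the partial sums over blocks bound the
oscillation of the smoothed process. -/
theorem abs_smoothedPath_sub_le (hEnv : HasEnvelope P X F)
    (hX : ∀ n i, 1 ≤ i → i ≤ n → Measurable (X n i)) (hF : ∀ f ∈ F, Measurable f)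
    (ρ : PseudoMetricSpace F) {n r : ℕ} (hr : 0 < r) {δ a : ℝ} (hrδ : n * δ ≤ r) {ω : Ω}
    (hD : ∀ φ ∈ differences ρ δ, ∀ l ≤ n,
      |∑ k ∈ Finset.Ico 1 (1 + l), centered P X n k φ ω| ≤ a)
    (hO : ∀ f ∈ F, ∀ b l, l ≤ r → b * r + l ≤ n →
      |∑ k ∈ Finset.Ico (b * r + 1) (b * r + 1 + l), centered P X n k f ω| ≤ a)
    {p q : intervalClass × F} (hpq : tau ρ p q ≤ δ) :
    |smoothedPath P X F n ω p - smoothedPath P X F n ω q| ≤ (1 / √(n : ℝ)) * (8 * a) := by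
  obtain ⟨⟨_, u, v, hu, huv, hv, rfl⟩, f⟩ := p
  obtain ⟨⟨_, u', v', hu', huv', hv', rfl⟩, g⟩ := q
  simp only [tau] at hpq
  have hρ : 0 ≤ ρ.dist f g := @dist_nonneg F ρ f g
  have hvol : 0 ≤ volume.real (Ioc u v ∆ Ioc u' v') := measureReal_nonneg
  have hn0 : (0 : ℝ) ≤ n := Nat.cast_nonneg n
  simp only [smoothedPath]
  rw [smoothedProcess_Ioc n ω huv, smoothedProcess_Ioc n ω huv', ← mul_sub, abs_mul,
    abs_of_nonneg (by positivity : 0 ≤ 1 / √(n : ℝ))]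
  refine mul_le_mul_of_nonneg_left ?_ (by positivity)
  set If := interpolation n fun i => centered P X n i f ω with hIf
  set Ig := interpolation n fun i => centered P X n i g ω with hIg
  have hscale : ∀ z : ℝ, 0 ≤ z → z ≤ 1 → 0 ≤ n * z ∧ n * z ≤ n := fun z h0 h1 =>
    ⟨by positivity, by nlinarith⟩
  have hinc : ∀ t : ℝ, 0 ≤ t → t ≤ n → |(If t - Ig t) - (If 0 - Ig 0)| ≤ a := by
    have hlin : ∀ t, If t - Ig t =
        interpolation n (fun i => centered P X n i ((f : 𝓧 → ℝ) - g) ω) t := by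
      intro t
      simp only [hIf, hIg, interpolation]
      rw [← Finset.sum_sub_distrib]
      refine Finset.sum_congr rfl fun i hi => ?_
      rw [Finset.mem_Icc] at hi
      rw [centered_sub (hEnv.integrable hX hF f.2 hi.1 hi.2)
        (hEnv.integrable hX hF g.2 hi.1 hi.2), mul_sub]
    intro t ht0 htn
    rw [hlin, hlin]
    have := abs_interpolation_sub_nat_le (n := n) (a := 0) (m := n)
      (x := fun i => centered P X n i ((f : 𝓧 → ℝ) - g) ω) (t := t) (M := a) (by omega)
      (by simpa using ht0) (by simpa using htn) fun l hl => by
        simpa using hD _ ⟨f, g, by linarith, rfl⟩ l hl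
    simpa using this
  have hosc : ∀ s t, 0 ≤ s → s ≤ 1 → 0 ≤ t → t ≤ 1 → |s - t| ≤ δ →
      |Ig (n * s) - Ig (n * t)| ≤ 3 * a := by
    intro s t hs0 hs1 ht0 ht1 hst
    refine abs_interpolation_sub_le hr (hO g g.2) (hscale t ht0 ht1).1 (hscale t ht0 ht1).2
      (hscale s hs0 hs1).1 (hscale s hs0 hs1).2 ?_
    rw [← mul_sub, abs_mul, abs_of_nonneg hn0]
    exact (mul_le_mul_of_nonneg_left hst hn0).trans hrδ
  have hv1 : 0 ≤ v := hu.trans huv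
  have hv1' : 0 ≤ v' := hu'.trans huv'
  have hu1 : u ≤ 1 := huv.trans hv
  have hu1' : u' ≤ 1 := huv'.trans hv'
  have h1 := hinc (n * v) (hscale v hv1 hv).1 (hscale v hv1 hv).2
  have h2 := hinc (n * u) (hscale u hu hu1).1 (hscale u hu hu1).2
  -- Two oscillations of `3a` each; together with `a` at each of the two end points for passing from
  -- `f` to `g`, this makes `8a`.
  have h3 : |(Ig (n * v) - Ig (n * u)) - (Ig (n * v') - Ig (n * u'))| ≤ 6 * a := by
    rcases endpoints_close_or_short huv huv' (show _ ≤ δ by linarith) with ⟨h4, h5⟩ | ⟨h4, h5⟩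
    · have h6 := hosc u u' hu hu1 hu' hu1' h4
      have h7 := hosc v v' hv1 hv hv1' hv' h5
      rw [abs_le] at h6 h7 ⊢
      constructor <;> linarith
    · have h6 := hosc v u hv1 hv hu hu1 (by rwa [abs_of_nonneg (by linarith)])
      have h7 := hosc v' u' hv1' hv' hu' hu1' (by rwa [abs_of_nonneg (by linarith)])
      rw [abs_le] at h6 h7 ⊢
      constructor <;> linarith
  rw [abs_le] at h1 h2 h3 ⊢
  constructor <;> linarith

/-- The threshold `a = ε √n / 8` is chosen so that `8a / √n = ε`: an oscillation above `ε` forces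
the increment majorant or one of the `n / r + 1` block majorants to reach `a`, and Markov's
inequality bounds each of these events. -/
theorem measure_oscillation_le (hEnv : HasEnvelope P X F)
    (hX : ∀ n i, 1 ≤ i → i ≤ n → Measurable (X n i)) (hF : ∀ f ∈ F, Measurable f)
    (ρ : PseudoMetricSpace F) {ν Qg Qh : ℝ} (hν : 2 < ν) {g h : ℕ → ℝ} {n r : ℕ} {δ ε : ℝ}
    (hg : GrowthCondition (ν / 2) g Qg) (hh : GrowthCondition (ν / 2) h Qh)
    (hgm : ∀ i j, 1 ≤ i → i ≤ j → j ≤ n →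
      outerMoment P X (differences ρ δ) ν n i j ≤ ((g (j - i + 1) ^ (ν / 2) : ℝ) : EReal))
    (hhm : ∀ i j, 1 ≤ i → i ≤ j → j ≤ n →
      outerMoment P X F ν n i j ≤ ((h (j - i + 1) ^ (ν / 2) : ℝ) : EReal))
    (hn : 0 < n) (hr : 0 < r) (hrδ : n * δ ≤ r) (hε : 0 < ε) :
    P {ω | ENNReal.ofReal ε < ⨆ (p : intervalClass × F) (q : intervalClass × F)
        (_ : tau ρ p q ≤ δ), ‖smoothedPath P X F n ω p - smoothedPath P X F n ω q‖ₑ} ≤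
      ENNReal.ofReal (maximalConst ν (ν / 2) Qg ^ ν * (8 / ε) ^ ν * (g n / n) ^ (ν / 2) +
        ((n / r : ℕ) + 1) *
          (maximalConst ν (ν / 2) Qh ^ ν * (8 / ε) ^ ν * (h r / n) ^ (ν / 2))) := by
  have hν0 : 0 < ν := by linarith
  have hKg := (one_add_maximalConst_mul hν0 (by linarith : 1 < ν / 2) hg.one_le hg.lt).1
  have hKh := (one_add_maximalConst_mul hν0 (by linarith : 1 < ν / 2) hh.one_le hh.lt).1
  have hn' : (0 : ℝ) < n := by exact_mod_cast hn
  have hgn := hg.nonneg n hn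
  have hhr := hh.nonneg r hr
  set a := ε * √(n : ℝ) / 8 with ha
  have ha0 : 0 < a := by positivity
  obtain ⟨W, hWm, hW, hWi⟩ := exists_maximal_of_outerMoment hν hg hgm le_rfl hn (by omega)
  have hblock : ∀ b : ℕ, ∃ V : Ω → ℝ≥0∞, Measurable V ∧
      (∀ f ∈ F, ∀ ω l, l ≤ r → b * r + l ≤ n →
        ‖∑ k ∈ Finset.Ico (b * r + 1) (b * r + 1 + l), centered P X n k f ω‖ₑ ≤ V ω) ∧
      ∫⁻ ω, V ω ^ ν ∂P ≤ ENNReal.ofReal (maximalConst ν (ν / 2) Qh ^ ν * h r ^ (ν / 2)) := by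
    intro b
    rcases Nat.lt_or_ge (b * r) n with hb | hb
    · obtain ⟨V, hVm, hV, hVi⟩ := exists_maximal_of_outerMoment hν hh hhm
        (i := b * r + 1) (m := min r (n - b * r)) (by omega) (by omega) (by omega)
      refine ⟨V, hVm, fun f hf ω l hl hln => hV f hf ω l (by omega),
        hVi.trans (ENNReal.ofReal_le_ofReal ?_)⟩
      have := Real.rpow_le_rpow (hh.nonneg _ (by omega))
        (hh.mono (min r (n - b * r)) r (by omega) (min_le_left _ _)) (by linarith : 0 ≤ ν / 2)
      gcongr
    · refine ⟨fun _ => 0, measurable_const, fun f hf ω l hl hln => ?_, ?_⟩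
      · rw [show l = 0 by omega]; simp
      · simp [ENNReal.zero_rpow_of_pos hν0]
  choose V hVm hV hVi using hblock
  have hlt : ∀ {x : ℝ} {w : ℝ≥0∞}, ‖x‖ₑ ≤ w → w < ENNReal.ofReal a → |x| ≤ a := by
    intro x w hx hw
    rw [← ofReal_norm] at hx
    exact ((ENNReal.ofReal_lt_ofReal_iff ha0).1 (hx.trans_lt hw)).le
  have hsub : {ω | ENNReal.ofReal ε < ⨆ (p : intervalClass × F) (q : intervalClass × F)
        (_ : tau ρ p q ≤ δ), ‖smoothedPath P X F n ω p - smoothedPath P X F n ω q‖ₑ} ⊆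
      {ω | ENNReal.ofReal a ≤ W ω} ∪
        ⋃ b ∈ Finset.range (n / r + 1), {ω | ENNReal.ofReal a ≤ V b ω} := by
    intro ω hω
    by_contra hcon
    simp only [mem_union, mem_iUnion, not_or, not_exists, mem_ofPred_eq, not_le,
      Finset.mem_range] at hcon
    refine (not_le.2 (show ENNReal.ofReal ε < _ from hω)) (iSup₂_le fun p q => iSup_le fun hpq => ?_)
    have := abs_smoothedPath_sub_le hEnv hX hF ρ hr hrδ (ω := ω) (a := a)
      (fun φ hφ l hl => hlt (hW φ hφ ω l hl) hcon.1)
      (fun f hf b l hl hbl => hlt (hV b f hf ω l hl hbl) (hcon.2 b (by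
        rw [Nat.lt_succ_iff, Nat.le_div_iff_mul_le hr]; omega))) hpq
    rw [show 1 / √(n : ℝ) * (8 * a) = ε by rw [ha]; field_simp] at this
    rw [← ofReal_norm]
    exact ENNReal.ofReal_le_ofReal this
  refine (measure_mono hsub).trans ((measure_union_le _ _).trans ?_)
  rw [ENNReal.ofReal_add (by positivity) (by positivity)]
  refine add_le_add ?_ ((measure_biUnion_finset_le _ _).trans ?_)
  · rw [← div_scaled_rpow hε hgn]
    exact measure_ofReal_le_of_lintegral_rpow_le hWm hν0 ha0 hWi
  · rw [← div_scaled_rpow hε hhr]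
    refine (Finset.sum_le_card_nsmul _ _ _ fun b _ =>
      measure_ofReal_le_of_lintegral_rpow_le (hVm b) hν0 ha0 (hVi b)).trans_eq ?_
    rw [Finset.card_range, nsmul_eq_mul, ENNReal.ofReal_mul (by positivity)]
    congr 1
    rw [← Nat.cast_succ, ENNReal.ofReal_natCast]

/-- The moment conditions imply asymptotic equicontinuity of the smoothed process. -/
theorem aec_smoothedPath (hEnv : HasEnvelope P X F)
    (hX : ∀ n i, 1 ≤ i → i ≤ n → Measurable (X n i)) (hF : ∀ f ∈ F, Measurable f)
    (ρ : PseudoMetricSpace F) {ν : ℝ} (hν : 2 < ν) (hcond : MomentConditions P X F ρ ν) :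
    AEC P (smoothedPath P X F) (tau ρ) := by
  obtain ⟨g, h, Qg, Qh, C, hgm, hg, hhm, hh, hglim, hC, hhlim⟩ := hcond
  intro ε hε
  have hν0 : 0 < ν := by linarith
  rw [ENNReal.tendsto_nhds_zero]
  intro η' hη'
  obtain ⟨η, hη0, hηη⟩ := ENNReal.lt_iff_exists_nnreal_btwn.1 hη'
  have hη : (0 : ℝ) < η := by exact_mod_cast hη0
  set cg := maximalConst ν (ν / 2) Qg ^ ν * (8 / ε) ^ ν with hcg
  set ch := maximalConst ν (ν / 2) Qh ^ ν * (8 / ε) ^ ν with hch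
  have hKg := (one_add_maximalConst_mul hν0 (by linarith : 1 < ν / 2)
    (hg 1 one_pos).one_le (hg 1 one_pos).lt).1
  have hKh := (one_add_maximalConst_mul hν0 (by linarith : 1 < ν / 2) hh.one_le hh.lt).1
  have hcg0 : 0 < cg := by positivity
  have hch0 : 0 < ch := by positivity
  have hpow : ∀ (c s : ℝ), 0 < s →
      ∀ᶠ x in 𝓝[>] (0 : ℝ), c * x ^ s < η / 2 := by
    intro c s hs
    have h1 : Tendsto (fun x : ℝ => c * x ^ s) (𝓝 0) (𝓝 (c * 0 ^ s)) :=
      ((Real.continuousAt_rpow_const 0 s (Or.inr hs.le)).tendsto).const_mul c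
    rw [Real.zero_rpow hs.ne', mul_zero] at h1
    exact (h1.mono_left nhdsWithin_le_nhds).eventually (gt_mem_nhds (by positivity))
  obtain ⟨κ, hκ, hκ0⟩ := ((hpow cg (ν / 2) (by positivity)).and self_mem_nhdsWithin).exists
  have hκ0 : 0 < κ := hκ0
  have hglim' := hglim.eventually (gt_mem_nhds (EReal.coe_pos.2 hκ0))
  -- The bound `δ < 1/2` keeps `2δ` in the range of the hypothesis on `h`; the last condition makes
  -- the total block probability, of order `δ ^ (ν / 2 - 1)`, small.
  filter_upwards [hglim', self_mem_nhdsWithin,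
    Ioo_mem_nhdsGT (show (0 : ℝ) < 1 / 2 by norm_num),
    hpow (2 * ch * (2 * (C + 1)) ^ (ν / 2)) (ν / 2 - 1) (by linarith)] with δ h1 hδ0 hδ2 h2
  have hδ0 : 0 < δ := hδ0
  refine limsup_le_of_le (h := ?_)
  have h3 := eventually_lt_of_limsup_lt h1
  have h4 := eventually_lt_of_limsup_lt ((hhlim (2 * δ) (by positivity) (by linarith [hδ2.2])).trans_lt
    (EReal.coe_lt_coe_iff.2 (by nlinarith : C * (2 * δ) < (C + 1) * (2 * δ))))
  filter_upwards [h3, h4, eventually_ge_atTop ⌈1 / δ⌉₊, eventually_gt_atTop 0] with n h5 h6 h7 hn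
  rw [EReal.coe_lt_coe_iff] at h5 h6
  have hn' : (0 : ℝ) < n := by exact_mod_cast hn
  have hnδ : 1 ≤ n * δ := by
    have : 1 / δ ≤ n := (Nat.le_ceil _).trans (by exact_mod_cast h7)
    rwa [div_le_iff₀ hδ0] at this
  -- The factor `2` absorbs the rounding: as `n δ ≥ 1`, the block length is still at least `n δ`.
  set r := ⌊(n : ℝ) * (2 * δ)⌋₊ with hr
  have hrδ : n * δ ≤ r := by
    have := Nat.lt_floor_add_one ((n : ℝ) * (2 * δ))
    linarith
  have hr0 : 0 < r := by
    have : (0 : ℝ) < r := by linarith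
    exact_mod_cast this
  have hr0' : (0 : ℝ) < r := by exact_mod_cast hr0
  have hgn := (hg δ hδ0).nonneg n hn
  have hhr := hh.nonneg r hr0
  refine (measure_oscillation_le hEnv hX hF ρ hν (hg δ hδ0) hh
    (fun i j => hgm n i j δ hδ0) (hhm n) hn hr0 hrδ hε).trans
    (le_trans (ENNReal.ofReal_le_ofReal (?_ : _ ≤ (η : ℝ))) (by simpa using hηη.le))
  have hfirst : cg * (g n δ / n) ^ (ν / 2) ≤ η / 2 := by
    refine le_trans ?_ hκ.le
    have := Real.rpow_le_rpow (by positivity : 0 ≤ g n δ / n) h5.le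
      (by positivity : 0 ≤ ν / 2)
    gcongr
  have hcount : ((n / r : ℕ) : ℝ) + 1 ≤ 2 / δ := by
    have e1 : ((n / r : ℕ) : ℝ) ≤ n / r := Nat.cast_div_le
    have e2 : (n : ℝ) / r ≤ 1 / δ := by
      rw [div_le_div_iff₀ hr0' hδ0]; linarith
    have e3 : 1 ≤ 1 / δ := by rw [le_div_iff₀ hδ0]; linarith [hδ2.2]
    have e4 : 2 / δ = 1 / δ + 1 / δ := by ring
    linarith
  have hsecond : (((n / r : ℕ) : ℝ) + 1) * (ch * (h r / n) ^ (ν / 2)) ≤ η / 2 := by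
    refine le_trans ?_ h2.le
    have e1 := Real.rpow_le_rpow (by positivity : 0 ≤ h r / n) h6.le
      (by positivity : 0 ≤ ν / 2)
    calc (((n / r : ℕ) : ℝ) + 1) * (ch * (h r / n) ^ (ν / 2))
        ≤ 2 / δ * (ch * ((C + 1) * (2 * δ)) ^ (ν / 2)) := by gcongr
      _ = 2 * ch * (2 * (C + 1)) ^ (ν / 2) * δ ^ (ν / 2 - 1) := by
          rw [show (C + 1) * (2 * δ) = 2 * (C + 1) * δ by ring,
            Real.mul_rpow (by positivity) hδ0.le, Real.rpow_sub_one hδ0.ne']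
          ring
  linarith

end Equicontinuity

/-! ### Finite nets for the index set -/

section TotallyBounded

variable {𝓧 : Type*} {F : Set (𝓧 → ℝ)}

/-- The intervals with end points in a grid of mesh `1 / M` form a `2 / M`-net. -/
theorem exists_finset_intervalClass (M : ℕ) (hM : 0 < M) :
    ∃ J : Finset intervalClass, ∀ A : intervalClass, ∃ B ∈ J,
      volume.real ((A : Set ℝ) ∆ (B : Set ℝ)) ≤ 2 / M := by
  classical
  have hM' : (0 : ℝ) < M := by exact_mod_cast hM
  -- Taking the minimum for the left end point makes every pair of grid indices a valid interval.
  have hgrid : ∀ p : Fin (M + 1) × Fin (M + 1),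
      Ioc ((min (p.1 : ℕ) p.2 : ℕ) / M : ℝ) ((p.2 : ℕ) / M : ℝ) ∈ intervalClass := by
    refine fun p => ⟨_, _, by positivity, ?_, ?_, rfl⟩
    · have : min (p.1 : ℕ) p.2 ≤ (p.2 : ℕ) := min_le_right _ _
      gcongr
    · rw [div_le_one hM']
      exact_mod_cast Nat.lt_succ_iff.1 p.2.2
  refine ⟨Finset.univ.image fun p => ⟨_, hgrid p⟩, ?_⟩
  rintro ⟨_, u, v, hu, huv, hv, rfl⟩
  have hidx : ∀ z : ℝ, 0 ≤ z → z ≤ 1 → ⌊z * M⌋₊ < M + 1 := fun z _ h1 =>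
    Nat.lt_succ_iff.2 (Nat.floor_le_of_le (by nlinarith))
  have hlow : ∀ z : ℝ, 0 ≤ z → (⌊z * M⌋₊ : ℝ) / M ≤ z := fun z h0 => by
    rw [div_le_iff₀ hM']; exact Nat.floor_le (by positivity)
  have hup : ∀ z : ℝ, z - (⌊z * M⌋₊ : ℝ) / M ≤ 1 / M := fun z => by
    rw [sub_le_iff_le_add, ← add_div, le_div_iff₀ hM', add_comm]
    exact (Nat.lt_floor_add_one _).le
  have hmono : ⌊u * M⌋₊ ≤ ⌊v * M⌋₊ := Nat.floor_mono (by gcongr)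
  refine ⟨_, Finset.mem_image_of_mem _ (Finset.mem_univ
    ((⟨⌊u * M⌋₊, hidx u hu (huv.trans hv)⟩, ⟨⌊v * M⌋₊, hidx v (hu.trans huv) hv⟩) :
      Fin (M + 1) × Fin (M + 1))), ?_⟩
  change volume.real (Ioc u v ∆
    Ioc (((min ⌊u * M⌋₊ ⌊v * M⌋₊ : ℕ) : ℝ) / M) ((⌊v * M⌋₊ : ℝ) / M)) ≤ 2 / M
  rw [min_eq_left hmono]
  have hsub : Ioc u v ∆ Ioc ((⌊u * M⌋₊ : ℝ) / M) ((⌊v * M⌋₊ : ℝ) / M) ⊆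
      Ioc ((⌊u * M⌋₊ : ℝ) / M) u ∪ Ioc ((⌊v * M⌋₊ : ℝ) / M) v := by
    have hu' := hlow u hu
    have hv' := hlow v (hu.trans huv)
    rintro z (⟨⟨h1, h2⟩, h3⟩ | ⟨⟨h1, h2⟩, h3⟩)
    · refine Or.inr ⟨?_, h2⟩
      by_contra! hcon
      exact h3 ⟨hu'.trans_lt h1, hcon⟩
    · refine Or.inl ⟨h1, ?_⟩
      by_contra! hcon
      exact h3 ⟨hcon, h2.trans hv'⟩
  calc volume.real (Ioc u v ∆ Ioc ((⌊u * M⌋₊ : ℝ) / M) ((⌊v * M⌋₊ : ℝ) / M))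
      ≤ volume.real (Ioc ((⌊u * M⌋₊ : ℝ) / M) u) + volume.real (Ioc ((⌊v * M⌋₊ : ℝ) / M) v) :=
        (measureReal_mono hsub ((measure_union_le _ _).trans_lt
          (by simp [ENNReal.add_lt_top])).ne).trans (measureReal_union_le _ _)
    _ ≤ 1 / M + 1 / M := by
        rw [Real.volume_real_Ioc_of_le (hlow u hu),
          Real.volume_real_Ioc_of_le (hlow v (hu.trans huv))]
        exact add_le_add (hup u) (hup v)
    _ = 2 / M := by ring

theorem exists_finset_tau_le (ρ : PseudoMetricSpace F)
    (htot : @TotallyBounded F ρ.toUniformSpace univ) {δ : ℝ} (hδ : 0 < δ) :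
    ∃ I : Finset (intervalClass × F), ∀ p, ∃ q ∈ I, tau ρ p q ≤ δ := by
  obtain ⟨M, hM⟩ := exists_nat_gt (4 / δ)
  have hM0 : (0 : ℝ) < M := lt_trans (by positivity) hM
  obtain ⟨J, hJ⟩ := exists_finset_intervalClass M (by exact_mod_cast hM0)
  obtain ⟨N, hN, hcover⟩ := (@Metric.totallyBounded_iff F ρ univ).1 htot (δ / 2) (by positivity)
  refine ⟨J ×ˢ hN.toFinset, fun p => ?_⟩
  obtain ⟨B, hB, hAB⟩ := hJ p.1
  obtain ⟨f, hf, hpf⟩ := mem_iUnion₂.1 (hcover (mem_univ p.2))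
  refine ⟨(B, f), Finset.mem_product.2 ⟨hB, hN.mem_toFinset.2 hf⟩, ?_⟩
  have h1 : ρ.dist p.2 f < δ / 2 := hpf
  have h2 : 2 / (M : ℝ) ≤ δ / 2 := by
    rw [div_lt_iff₀ hδ] at hM
    rw [div_le_div_iff₀ hM0 two_pos]; linarith
  simp only [tau]
  linarith

end TotallyBounded

theorem measurable_smoothedPath {Ω 𝓧 : Type*} [MeasurableSpace Ω] [MeasurableSpace 𝓧]
    {P : Measure Ω} {X : ℕ → ℕ → Ω → 𝓧} {F : Set (𝓧 → ℝ)}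
    (hX : ∀ n i, 1 ≤ i → i ≤ n → Measurable (X n i)) (hF : ∀ f ∈ F, Measurable f) (n : ℕ)
    (p : intervalClass × F) : Measurable fun ω => smoothedPath P X F n ω p := by
  refine Measurable.const_mul (Finset.measurable_sum _ fun i hi => ?_) _
  rw [Finset.mem_Icc] at hi
  exact (((hF p.2 p.2.2).comp (hX n i hi.1 hi.2)).sub_const _).const_mul _

end SmoothedSEP

end

theorem theorem3p2 {Ω 𝓧 : Type*} [MeasurableSpace Ω] [MeasurableSpace 𝓧]
    (P : MeasureTheory.Measure Ω) [MeasureTheory.IsProbabilityMeasure P]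
    (X : ℕ → ℕ → Ω → 𝓧) (hX : ∀ n i, 1 ≤ i → i ≤ n → Measurable (X n i))
    (F : Set (𝓧 → ℝ)) (hF : ∀ f ∈ F, Measurable f)
    (hEnv : SmoothedSEP.HasEnvelope P X F)
    (ρ : PseudoMetricSpace F) (ν : ℝ) (hν : 2 < ν)
    (hcond : SmoothedSEP.MomentConditions P X F ρ ν) :
    SmoothedSEP.AEC P (SmoothedSEP.smoothedPath P X F) (SmoothedSEP.tau ρ) ∧
    (@TotallyBounded F ρ.toUniformSpace Set.univ →
      ∀ m : ∀ I : Finset (SmoothedSEP.intervalClass × F),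
          MeasureTheory.ProbabilityMeasure (I → ℝ),
        SmoothedSEP.FidiConverges P (SmoothedSEP.smoothedPath P X F) m →
        ∃ L : MeasureTheory.Measure (SmoothedSEP.EllInfty (SmoothedSEP.intervalClass × F)),
          MeasureTheory.IsProbabilityMeasure L ∧
          MeasureTheory.IsTightMeasureSet {L} ∧
          (∀ I : Finset (SmoothedSEP.intervalClass × F),
            L.map (fun z => fun t : I => z t) =
              (m I : MeasureTheory.Measure (I → ℝ))) ∧
          SmoothedSEP.WeaklyConverges P (SmoothedSEP.smoothedMap hEnv) L) := by
  have haec := SmoothedSEP.aec_smoothedPath hEnv hX hF ρ hν hcond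
  refine ⟨haec, fun htot m hfidi => ?_⟩
  exact SmoothedSEP.exists_weaklyConverges_of_aec
    (SmoothedSEP.measurable_smoothedPath hX hF) (SmoothedSEP.memℓp_smoothedPath hEnv) haec
    (fun _ hδ => SmoothedSEP.exists_finset_tau_le ρ htot hδ) hfidi
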